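/- Let $\mathbb N=\{1,2,3,\dots\}$ and let $\phi$ be Euler's totient function. For $t\ge 1$ write $\operatorname{Log} t=\max\{1,\log t\}$, and for $v,w\in\mathbb N$ let $$\omega_t(v,w)=\#\Big\{p\le t \text{ prime}:\ p\ \Big|\ \frac{vw}{\gcd(v,w)^2}\Big\}.$$ For a finitely supported function $\psi:\mathbb N\to\mathbb R_{\ge 0}$ with support $V$, put $$\mu_\psi^\phi(V)=\sum_{v\in V}\frac{\phi(v)\psi(v)}{v},\qquad \mu_{\psi,\psi}^{\phi,\phi}(\mathcal E)=\sum_{(v,w)\in\mathcal E}\frac{\phi(v)\psi(v)}{v}\cdot\frac{\phi(w)\psi(w)}{w}\quad(\mathcal E\subset V\times V),$$ and for $K\in\mathbb R$ let $$\mathcal E_{\psi,\psi}^{t,K}=\Big\{(v,w)\in V\times V:\ \frac{\max(w\psi(v),v\psi(w))}{\gcd(v,w)}\le 1,\ \ \omega_t(v,w)\ge K\Big\}.$$ **Corollary.** For every $\epsilon\in(0,4/5]$ and every $C>0$ there is a constant $M=M(\epsilon,C)>0$ such that for all real $t\ge1$, all $K\in\mathbb R$ and all finitely supported $\psi:\mathbb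 N\to\mathbb R_{\ge0}$ with support $V$, $$\mu_{\psi,\psi}^{\phi,\phi}\big(\mathcal E_{\psi,\psi}^{t,K}\big)\ \le\ M\,(\operatorname{Log} t)^{\frac12(e^{80C}-1)}\,e^{-CK(1+\epsilon)}\,\mu_\psi^\phi(V)^{1+\epsilon}.$$ -/

import Mathlib

open scoped NNReal

namespace DuffinSchaeffer

noncomputable section

/-! Functions `ψ : {1, 2, 3, …} → ℝ≥0` of finite support are modelled as `ψ : ℕ →₀ ℝ≥0`; the theorem
adds the condition `ψ 0 = 0`, so that only positive integers occur. -/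

/-- `Log t = max {1, log t}`. -/
def Log (t : ℝ) : ℝ := max 1 (Real.log t)

/-- `ω_t(v, w)`: the number of primes `p ≤ t` dividing `v w / gcd(v, w) ^ 2` (an exact division),
for positive integers `v` and `w`. -/
def omega (t : ℝ) (v w : ℕ) : ℕ :=
  ((v * w / Nat.gcd v w ^ 2).primeFactors.filter fun p : ℕ => (p : ℝ) ≤ t).card

/-- `D_{ψ,θ}(v, w) = max (w ψ(v), v θ(w)) / gcd(v, w)`. -/
def D (ψ θ : ℕ →₀ ℝ≥0) (v w : ℕ) : ℝ :=
  max ((w : ℝ) * (ψ v : ℝ)) ((v : ℝ) * (θ w : ℝ)) / (Nat.gcd v w : ℝ)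

/-- The weight `μ_ψ^f(v) = f(v) ψ(v) / v` of a single positive integer. -/
def weight (f : ℕ → ℝ) (ψ : ℕ →₀ ℝ≥0) (v : ℕ) : ℝ := f v * (ψ v : ℝ) / (v : ℝ)

/-- The weight `μ_ψ^f(V)` of a finite set of integers. -/
def mu (f : ℕ → ℝ) (ψ : ℕ →₀ ℝ≥0) (V : Finset ℕ) : ℝ := ∑ v ∈ V, weight f ψ v

/-- The weight `μ_{ψ,θ}^{f,g}(E)` of a finite set of pairs of integers. -/
def muPair (f g : ℕ → ℝ) (ψ θ : ℕ →₀ ℝ≥0) (E : Finset (ℕ × ℕ)) : ℝ :=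
  ∑ x ∈ E, weight f ψ x.1 * weight g θ x.2

/-- The set of pairs `(v, w) ∈ supp ψ × supp θ` with `D_{ψ,θ}(v, w) ≤ 1` and `ω_t(v, w) ≥ K`. -/
def pairSet (ψ θ : ℕ →₀ ℝ≥0) (t K : ℝ) : Finset (ℕ × ℕ) :=
  {x ∈ ψ.support ×ˢ θ.support | D ψ θ x.1 x.2 ≤ 1 ∧ K ≤ (omega t x.1 x.2 : ℝ)}

/-- Euler's totient function with real values. -/
def phi (n : ℕ) : ℝ := (Nat.totient n : ℝ)

end

end DuffinSchaeffer

/-!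
The proof compares the weight `Y` of a set of pairs with the product `X` of the weights of its two
sides, and shows `Y ≤ T * X ^ q` with `q = (1 + ε) / 2 > 1 / 2` for two unrelated weights, by
induction on the set `P` of primes that are taken into account (`Bound`, `exists_bound`).

*Removing a prime.* The pairs `(v, w)` with `v_p = i` and `w_p = j` form a system of the same kind
without the prime `p`, once the two weights are rescaled, and the induction hypothesis bounds their
weight by `T * c * r ^ |i - j| * (α i * β j) ^ q`, where `c = 1` for `i = j` and `c = exp (2 * C)`
otherwise, `r = p ^ (-(1 - q))`, and `α`, `β` are the weights of the fibres (`pairMass_fiber_le`).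
Schur's test shows that adding a prime costs at most a constant factor (`Bound.of_erase`), which is
affordable for boundedly many primes.
At a large prime, the bound persists with the same constant unless `α` and `β` are both concentrated
at a common valuation `k p`, up to a proportion `O(1 / p)` (`concentration`). The pairs avoiding
`k p` on both sides then make up a proportion `O(p ^ (-(1 + ε)))` of `Y` (`exists_concentration`),
and since `ε > 0` this is summable over `p`.

*The concentrated case.* If this happens at all primes of `P`, and these are large, half of the
weight lies on pairs in which, at every prime `p`, some component has valuation exactly `k p`. Put
`N = ∏ p ^ k p` and write `v = N * v⁺ / v⁻`. For such a pair `v / gcd(v, w) = v⁺ * w⁻`, so that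
`D(v, w) ≤ 1` says that the weights satisfy `θ(w) ≤ 1 / (v⁺ * w⁻)` and `ψ(v) ≤ 1 / (w⁺ * v⁻)`. After
passing to a subgraph with large minimum degrees (`exists_large_degrees`), consider the vertices `v₀`
and `w₀` with the largest numerators. By `∑_{d ∣ N} φ(N / d) = N`, the neighbourhood of `v₀` has
weight at most `w₀⁺ / v₀⁺` and that of `w₀` at most `v₀⁺ / w₀⁺` (`mass_neighbours_le`), and the product
of these bounds is `1`; this gives `Y ≪ X ^ (1 / 2)`. The condition `ω_t ≥ K` forces one of the two
neighbourhoods to consist of integers with at least `K / 2` small primes in `w⁺ * w⁻`; Rankin's trick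
gains an exponential factor there, at the cost of the power of `Log t` that comes out of Mertens'
upper bound for `∑_{p ≤ t} 1 / p` (`sum_inv_primes_le`). Interpolating with the trivial bound `Y ≤ X`
gives the exponent `q` (`bound_of_concentrated`).
-/

namespace DuffinSchaeffer

/-! ### Sums over primes and mean values of multiplicative functions -/

/-- Legendre's formula gives `∑_{p ≤ n} ⌊n / p⌋ log p ≤ log n!`; Chebyshev's bound `θ(n) ≤ n log 4`
absorbs the error made by dropping the floors. -/
lemma sum_log_div_le (n : ℕ) (hn : 1 ≤ n) :
    ∑ p ∈ Nat.primesLE n, Real.log p / p ≤ Real.log n + Real.log 4 := by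
  have hn0 : (0 : ℝ) < n := by exact_mod_cast hn
  have hdvd : ∏ p ∈ Nat.primesLE n, p ^ (n / p) ∣ n.factorial := by
    apply Finset.prod_dvd_of_isRelPrime
    · intro p hp r hr hpr
      have hp' := Nat.prime_of_mem_primesLE hp
      have hr' := Nat.prime_of_mem_primesLE hr
      exact Nat.coprime_iff_isRelPrime.1 (((Nat.coprime_primes hp' hr').2 hpr).pow _ _)
    · intro p hp
      have hp' := Nat.prime_of_mem_primesLE hp
      rw [hp'.pow_dvd_factorial_iff (b := Nat.log p n + 2) (by omega)]
      have := Finset.single_le_sum (f := fun i => n / p ^ i) (fun _ _ => Nat.zero_le _)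
        (Finset.mem_Ico.2 ⟨le_rfl, by omega⟩ : 1 ∈ Finset.Ico 1 (Nat.log p n + 2))
      simpa using this
  have hle : ∏ p ∈ Nat.primesLE n, p ^ (n / p) ≤ n ^ n :=
    (Nat.le_of_dvd (Nat.factorial_pos n) hdvd).trans (Nat.factorial_le_pow n)
  have hlog : ∑ p ∈ Nat.primesLE n, ((n / p : ℕ) : ℝ) * Real.log p ≤ n * Real.log n := by
    have h1 : Real.log ((∏ p ∈ Nat.primesLE n, p ^ (n / p) : ℕ) : ℝ) ≤ Real.log ((n ^ n : ℕ) : ℝ) := by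
      apply Real.log_le_log
      · exact_mod_cast Finset.prod_pos fun p hp =>
          pow_pos (Nat.prime_of_mem_primesLE hp).pos _
      · exact_mod_cast hle
    rw [Nat.cast_prod, Real.log_prod] at h1
    · simpa using h1
    · intro p hp
      exact_mod_cast (pow_pos (Nat.prime_of_mem_primesLE hp).pos _).ne'
  have hth : ∑ p ∈ Nat.primesLE n, Real.log p ≤ Real.log 4 * n := by
    rw [← Chebyshev.theta_eq_sum_primesLE_log]
    exact Chebyshev.theta_le_log4_mul_x hn0.le
  have key : n * ∑ p ∈ Nat.primesLE n, Real.log p / p ≤ n * (Real.log n + Real.log 4) := by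
    calc n * ∑ p ∈ Nat.primesLE n, Real.log p / p
        ≤ ∑ p ∈ Nat.primesLE n, (((n / p : ℕ) : ℝ) * Real.log p + Real.log p) := by
          rw [Finset.mul_sum]
          refine Finset.sum_le_sum fun p hp => ?_
          have hp' := Nat.prime_of_mem_primesLE hp
          have h2 : (n : ℝ) / p ≤ ((n / p : ℕ) : ℝ) + 1 := by
            rw [← Nat.floor_div_eq_div (K := ℝ)]
            exact (Nat.lt_floor_add_one _).le
          have h3 : 0 ≤ Real.log p := Real.log_natCast_nonneg p
          calc (n : ℝ) * (Real.log p / p) = (n : ℝ) / p * Real.log p := by ring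
            _ ≤ (((n / p : ℕ) : ℝ) + 1) * Real.log p := by gcongr
            _ = _ := by ring
      _ ≤ _ := by rw [Finset.sum_add_distrib]; linarith
  exact le_of_mul_le_mul_left key hn0

/-- One direction of Mertens' second theorem, by partial summation from `sum_log_div_le`: the
difference `∑ 1 / p - (∑ log p / p) / log n` is estimated by induction on `n`. -/
lemma sum_inv_primes_le (n : ℕ) (hn : 2 ≤ n) :
    ∑ p ∈ Nat.primesLE n, (1 : ℝ) / p ≤
      Real.log (Real.log n) + (1 + Real.log 4 / Real.log 2 - Real.log (Real.log 2)) := by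
  have hpos : ∀ m : ℕ, 2 ≤ m → 0 < Real.log m := fun m hm =>
    Real.log_pos (by exact_mod_cast hm)
  have main : ∑ p ∈ Nat.primesLE n, (1 : ℝ) / p
      - (∑ p ∈ Nat.primesLE n, Real.log p / p) / Real.log n ≤
      Real.log (Real.log n) - Real.log (Real.log 2)
        + Real.log 4 * (1 / Real.log 2 - 1 / Real.log n) := by
    induction n, hn using Nat.le_induction with
    | base =>
      have : Nat.primesLE 2 = {2} := by decide
      rw [this]
      have h2 := hpos 2 le_rfl
      push_cast at h2 ⊢
      simp only [Finset.sum_singleton]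
      push_cast
      have : Real.log 2 / 2 / Real.log 2 = 1 / 2 := by field_simp
      rw [this]; simp
    | succ m hm ih =>
      set S := ∑ p ∈ Nat.primesLE m, Real.log p / p with hS
      set A := ∑ p ∈ Nat.primesLE m, (1 : ℝ) / p with hA
      have hl := hpos m hm
      have hl' := hpos (m + 1) (by omega)
      have hll : Real.log m ≤ Real.log (m + 1 : ℕ) :=
        Real.log_le_log (by positivity) (by push_cast; linarith)
      have hSle : S ≤ Real.log m + Real.log 4 := sum_log_div_le m (by omega)
      have heq : ∑ p ∈ Nat.primesLE (m + 1), (1 : ℝ) / p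
          - (∑ p ∈ Nat.primesLE (m + 1), Real.log p / p) / Real.log (m + 1 : ℕ)
          = A - S / Real.log (m + 1 : ℕ) := by
        by_cases hp : (m + 1).Prime
        · have h1 : Nat.primesLE (m + 1) = insert (m + 1) (Nat.primesLE m) := by
            ext p
            simp only [Nat.mem_primesLE, Finset.mem_insert]
            constructor
            · rintro ⟨h1, h2⟩
              by_cases h : p = m + 1
              · exact Or.inl h
              · exact Or.inr ⟨by omega, h2⟩
            · rintro (rfl | ⟨h1, h2⟩)
              · exact ⟨le_rfl, hp⟩
              · exact ⟨by omega, h2⟩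
          have h2 : m + 1 ∉ Nat.primesLE m := by simp [Nat.mem_primesLE]
          rw [h1, Finset.sum_insert h2, Finset.sum_insert h2, ← hA, ← hS]
          field_simp
          ring
        · have h1 : Nat.primesLE (m + 1) = Nat.primesLE m := by
            ext p
            simp only [Nat.mem_primesLE]
            constructor
            · rintro ⟨h1, h2⟩
              have : p ≠ m + 1 := by rintro rfl; exact hp h2
              exact ⟨by omega, h2⟩
            · rintro ⟨h1, h2⟩
              exact ⟨by omega, h2⟩
          rw [h1]
      rw [heq]
      have hinv : 1 / Real.log (m + 1 : ℕ) ≤ 1 / Real.log m := one_div_le_one_div_of_le hl hll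
      have h1 : S * (1 / Real.log m - 1 / Real.log (m + 1 : ℕ)) ≤
          (Real.log m + Real.log 4) * (1 / Real.log m - 1 / Real.log (m + 1 : ℕ)) :=
        mul_le_mul_of_nonneg_right hSle (by linarith)
      have h2 : Real.log (Real.log m / Real.log (m + 1 : ℕ)) ≤
          Real.log m / Real.log (m + 1 : ℕ) - 1 := Real.log_le_sub_one_of_pos (by positivity)
      rw [Real.log_div hl.ne' hl'.ne'] at h2
      have h3 : Real.log m * (1 / Real.log m) = 1 := by field_simp
      have e1 : S / Real.log (m + 1 : ℕ) = S * (1 / Real.log (m + 1 : ℕ)) := by ring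
      have e2 : S / Real.log m = S * (1 / Real.log m) := by ring
      have e3 : Real.log m / Real.log (m + 1 : ℕ) = Real.log m * (1 / Real.log (m + 1 : ℕ)) := by ring
      rw [e1]; rw [e2] at ih; rw [e3] at h2
      nlinarith
  have hl := hpos n hn
  have h1 : (∑ p ∈ Nat.primesLE n, Real.log p / p) / Real.log n ≤
      1 + Real.log 4 * (1 / Real.log n) := by
    rw [div_le_iff₀ hl]
    have := sum_log_div_le n (by omega)
    have h3 : (1 + Real.log 4 * (1 / Real.log n)) * Real.log n = Real.log n + Real.log 4 := by
      field_simp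
    linarith
  have e : Real.log 4 / Real.log 2 = Real.log 4 * (1 / Real.log 2) := by ring
  rw [e]; linarith

lemma Log_pos (t : ℝ) : 0 < Log t := lt_of_lt_of_le one_pos (le_max_left _ _)

lemma one_le_Log (t : ℝ) : 1 ≤ Log t := le_max_left _ _

/-- The Euler product that governs both mean values in the argument. -/
lemma exists_prod_one_add_div_le (c : ℝ) (hc : 0 ≤ c) :
    ∃ κ : ℝ, 1 ≤ κ ∧ ∀ (t : ℝ) (P : Finset ℕ), (∀ p ∈ P, p.Prime) → (∀ p ∈ P, (p : ℝ) ≤ t) →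
      ∏ p ∈ P, (1 + c / (p : ℝ)) ≤ κ * Log t ^ c := by
  set m : ℝ := |1 + Real.log 4 / Real.log 2 - Real.log (Real.log 2)| with hm
  refine ⟨Real.exp (c * m), Real.one_le_exp (by positivity), fun t P hP hPt => ?_⟩
  have hL := Log_pos t
  have h1 : ∏ p ∈ P, (1 + c / (p : ℝ)) ≤ Real.exp (c * ∑ p ∈ P, (1 : ℝ) / p) := by
    rw [Finset.mul_sum, Real.exp_sum]
    refine Finset.prod_le_prod (fun p _ => by positivity) fun p _ => ?_
    have := Real.add_one_le_exp (c * (1 / (p : ℝ)))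
    have e : c / (p : ℝ) = c * (1 / (p : ℝ)) := by ring
    rw [e]; linarith
  have h2 : ∑ p ∈ P, (1 : ℝ) / p ≤ Real.log (Log t) + m := by
    by_cases ht : t < 2
    · have : P = ∅ := by
        rw [Finset.eq_empty_iff_forall_notMem]
        intro p hp
        have h1 : (2 : ℝ) ≤ p := by exact_mod_cast (hP p hp).two_le
        have := hPt p hp
        linarith
      rw [this]
      have := Real.log_nonneg (one_le_Log t)
      simp only [Finset.sum_empty]
      positivity
    · push Not at ht
      have hn : 2 ≤ ⌊t⌋₊ := Nat.le_floor (by exact_mod_cast ht)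
      have hsub : P ⊆ Nat.primesLE ⌊t⌋₊ := fun p hp =>
        Nat.mem_primesLE.2 ⟨Nat.le_floor (hPt p hp), hP p hp⟩
      have h3 := Finset.sum_le_sum_of_subset_of_nonneg (f := fun p : ℕ => (1 : ℝ) / p) hsub
        (fun _ _ _ => by positivity)
      have h4 := sum_inv_primes_le _ hn
      have h5 : Real.log (Real.log ⌊t⌋₊) ≤ Real.log (Log t) := by
        apply Real.log_le_log
        · exact Real.log_pos (by exact_mod_cast hn)
        · refine le_trans (Real.log_le_log ?_ (Nat.floor_le (by linarith))) (le_max_right _ _)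
          exact_mod_cast (by omega : 0 < ⌊t⌋₊)
      have h6 := le_abs_self (1 + Real.log 4 / Real.log 2 - Real.log (Real.log 2))
      linarith
  calc _ ≤ _ := h1
    _ ≤ Real.exp (c * (Real.log (Log t) + m)) := by gcongr
    _ = _ := by
      rw [Real.rpow_def_of_pos hL, ← Real.exp_add]
      congr 1; ring

/-- The mean value of `∏_{p ∣ n, p ∈ Q} (1 + c)`: expand over the sets of primes dividing `n` and
count multiples, with no loss since every `⌊U / d⌋` is at most `U / d`. -/
lemma sum_prod_ite_dvd_le (Q : Finset ℕ) (hQ : ∀ p ∈ Q, p.Prime) (c : ℝ) (hc : 0 ≤ c) (U : ℕ) :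
    ∑ u ∈ Finset.Icc 1 U, ∏ p ∈ Q, (if p ∣ u then 1 + c else 1) ≤
      U * ∏ p ∈ Q, (1 + c / (p : ℝ)) := by
  have h1 : ∀ u : ℕ, ∏ p ∈ Q, (if p ∣ u then 1 + c else 1) =
      ∑ S ∈ Q.powerset, if (∏ p ∈ S, p) ∣ u then c ^ S.card else 0 := by
    intro u
    have : ∀ p ∈ Q, (if p ∣ u then 1 + c else 1) = 1 + (if p ∣ u then c else 0) := by
      intro p _; split_ifs <;> simp
    rw [Finset.prod_congr rfl this, Finset.prod_one_add]
    refine Finset.sum_congr rfl fun S hS => ?_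
    rw [Finset.mem_powerset] at hS
    by_cases h : (∏ p ∈ S, p) ∣ u
    · rw [if_pos h, Finset.prod_congr rfl (g := fun _ => c), Finset.prod_const]
      intro p hp
      rw [if_pos ((Finset.dvd_prod_of_mem (fun p => p) hp).trans h)]
    · rw [if_neg h]
      have : ∃ p ∈ S, ¬ p ∣ u := by
        by_contra! hcon
        exact h (Finset.prod_primes_dvd u (fun p hp => Nat.prime_iff.1 (hQ p (hS hp))) hcon)
      obtain ⟨p, hp, hpu⟩ := this
      exact Finset.prod_eq_zero hp (if_neg hpu)
  simp_rw [h1]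
  rw [Finset.sum_comm, Finset.prod_one_add, Finset.mul_sum]
  refine Finset.sum_le_sum fun S hS => ?_
  rw [← Finset.sum_filter, Finset.sum_const, nsmul_eq_mul, Finset.prod_div_distrib,
    Finset.prod_const]
  have h2 : (((Finset.Icc 1 U).filter fun u => (∏ p ∈ S, p) ∣ u).card : ℝ) ≤
      U / ((∏ p ∈ S, p : ℕ) : ℝ) := by
    have : (Finset.Icc 1 U).filter (fun u => (∏ p ∈ S, p) ∣ u) =
        (Finset.Ioc 0 U).filter (fun u => (∏ p ∈ S, p) ∣ u) := by
      ext; simp [Nat.succ_le_iff]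
    rw [this, Nat.Ioc_filter_dvd_card_eq_div]
    exact Nat.cast_div_le
  push_cast at h2 ⊢
  calc _ ≤ (U : ℝ) / (∏ p ∈ S, (p : ℝ)) * c ^ S.card := by gcongr
    _ = _ := by ring

/-! ### Near-diagonal forms -/

lemma sum_rpow_le_rpow_sum (S : Finset ℕ) (α : ℕ → ℝ) (hα : ∀ i ∈ S, 0 ≤ α i) (s : ℝ)
    (hs : 1 ≤ s) : ∑ i ∈ S, α i ^ s ≤ (∑ i ∈ S, α i) ^ s := by
  have h0 : 0 ≤ ∑ i ∈ S, α i := Finset.sum_nonneg hα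
  have e : ∀ x : ℝ, 0 ≤ x → x ^ s = x * x ^ (s - 1) := fun x hx => by
    have := Real.rpow_add_of_nonneg hx zero_le_one (by linarith : 0 ≤ s - 1)
    rw [Real.rpow_one] at this
    rw [← this]; ring_nf
  rw [e _ h0, Finset.sum_mul]
  refine Finset.sum_le_sum fun i hi => ?_
  rw [e _ (hα i hi)]
  have h1 : α i ≤ ∑ i ∈ S, α i := Finset.single_le_sum hα hi
  exact mul_le_mul_of_nonneg_left (Real.rpow_le_rpow (hα i hi) h1 (by linarith)) (hα i hi)

/-- Schur's test for the kernel `k`, applied to the vectors `α ^ q` and `β ^ q`, whose `ℓ²` norms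
are at most `(∑ α) ^ q` and `(∑ β) ^ q` because `2 q ≥ 1`. -/
lemma schur_test (S : Finset ℕ) (k : ℕ → ℕ → ℝ) (κ : ℝ) (hκ : 0 ≤ κ) (hk : ∀ i j, 0 ≤ k i j)
    (hrow : ∀ i ∈ S, ∑ j ∈ S, k i j ≤ κ) (hcol : ∀ j ∈ S, ∑ i ∈ S, k i j ≤ κ)
    (α β : ℕ → ℝ) (hα : ∀ i ∈ S, 0 ≤ α i) (hβ : ∀ i ∈ S, 0 ≤ β i) (q : ℝ) (hq : 1 / 2 ≤ q) :
    ∑ i ∈ S, ∑ j ∈ S, k i j * (α i * β j) ^ q ≤ κ * ((∑ i ∈ S, α i) * ∑ j ∈ S, β j) ^ q := by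
  have ha : 0 ≤ ∑ i ∈ S, α i := Finset.sum_nonneg hα
  have hb : 0 ≤ ∑ i ∈ S, β i := Finset.sum_nonneg hβ
  have hsq : ∀ x : ℝ, 0 ≤ x → (x ^ q) ^ 2 = x ^ (2 * q) := fun x hx => by
    rw [← Real.rpow_natCast (x ^ q) 2, ← Real.rpow_mul hx]; congr 1; push_cast; ring
  rw [← Finset.sum_product']
  refine (abs_le_of_sq_le_sq' ?_ (by positivity)).2
  have hcs := Finset.sum_sq_le_sum_mul_sum_of_sq_le_mul (S ×ˢ S)
    (r := fun x => k x.1 x.2 * (α x.1 * β x.2) ^ q)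
    (f := fun x => k x.1 x.2 * α x.1 ^ (2 * q)) (g := fun x => k x.1 x.2 * β x.2 ^ (2 * q))
    (fun x hx => mul_nonneg (hk _ _) (Real.rpow_nonneg (hα _ (Finset.mem_product.1 hx).1) _))
    (fun x hx => mul_nonneg (hk _ _) (Real.rpow_nonneg (hβ _ (Finset.mem_product.1 hx).2) _))
    (fun x hx => by
      have h1 := hα _ (Finset.mem_product.1 hx).1
      have h2 := hβ _ (Finset.mem_product.1 hx).2
      rw [mul_pow, hsq _ (mul_nonneg h1 h2), Real.mul_rpow h1 h2]; exact le_of_eq (by ring))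
  refine hcs.trans ?_
  have h1 : ∑ x ∈ S ×ˢ S, k x.1 x.2 * α x.1 ^ (2 * q) ≤ κ * (∑ i ∈ S, α i) ^ (2 * q) := by
    rw [Finset.sum_product' (f := fun i j => k i j * α i ^ (2 * q))]
    calc _ = ∑ i ∈ S, (∑ j ∈ S, k i j) * α i ^ (2 * q) := by simp_rw [Finset.sum_mul]
      _ ≤ ∑ i ∈ S, κ * α i ^ (2 * q) := Finset.sum_le_sum fun i hi =>
          mul_le_mul_of_nonneg_right (hrow i hi) (Real.rpow_nonneg (hα i hi) _)
      _ = κ * ∑ i ∈ S, α i ^ (2 * q) := by rw [Finset.mul_sum]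
      _ ≤ _ := mul_le_mul_of_nonneg_left (sum_rpow_le_rpow_sum S α hα _ (by linarith)) hκ
  have h2 : ∑ x ∈ S ×ˢ S, k x.1 x.2 * β x.2 ^ (2 * q) ≤ κ * (∑ i ∈ S, β i) ^ (2 * q) := by
    rw [Finset.sum_product_right' (f := fun i j => k i j * β j ^ (2 * q))]
    calc _ = ∑ j ∈ S, (∑ i ∈ S, k i j) * β j ^ (2 * q) := by simp_rw [Finset.sum_mul]
      _ ≤ ∑ j ∈ S, κ * β j ^ (2 * q) := Finset.sum_le_sum fun i hi =>
          mul_le_mul_of_nonneg_right (hcol i hi) (Real.rpow_nonneg (hβ i hi) _)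
      _ = κ * ∑ i ∈ S, β i ^ (2 * q) := by rw [Finset.mul_sum]
      _ ≤ _ := mul_le_mul_of_nonneg_left (sum_rpow_le_rpow_sum S β hβ _ (by linarith)) hκ
  calc _ ≤ (κ * (∑ i ∈ S, α i) ^ (2 * q)) * (κ * (∑ i ∈ S, β i) ^ (2 * q)) :=
        mul_le_mul h1 h2 (Finset.sum_nonneg fun x hx => mul_nonneg (hk _ _)
          (Real.rpow_nonneg (hβ _ (Finset.mem_product.1 hx).2) _)) (by positivity)
    _ = _ := by rw [mul_pow, hsq _ (mul_nonneg ha hb), Real.mul_rpow ha hb]; ring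

/-- The distance `|i - j|`, as a sum of two truncated differences. -/
def dist (i j : ℕ) : ℕ := (i - j) + (j - i)

lemma dist_comm (i j : ℕ) : dist i j = dist j i := by unfold dist; omega

lemma geom_sum_le (r : ℝ) (h0 : 0 ≤ r) (h1 : r < 1) (n : ℕ) :
    ∑ m ∈ Finset.range n, r ^ (m + 1) ≤ r / (1 - r) := by
  have h := (summable_geometric_of_lt_one h0 h1).sum_le_tsum (Finset.range n)
    (fun i _ => pow_nonneg h0 i)
  rw [tsum_geometric_of_lt_one h0 h1] at h
  calc _ = r * ∑ m ∈ Finset.range n, r ^ m := by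
        rw [Finset.mul_sum]; exact Finset.sum_congr rfl fun m _ => by ring
    _ ≤ r * (1 - r)⁻¹ := by gcongr
    _ = _ := by ring

/-- The kernel `0` on the diagonal, `c r ^ |i - j|` off it. -/
def offKernel (c r : ℝ) (i j : ℕ) : ℝ := if i = j then 0 else c * r ^ dist i j

/-- The kernel `1` on the diagonal, `c r ^ |i - j|` off it. -/
def kernel (c r : ℝ) (i j : ℕ) : ℝ := if i = j then 1 else c * r ^ dist i j

section kernel

variable {c r : ℝ}

lemma offKernel_nonneg (hc : 0 ≤ c) (h0 : 0 ≤ r) (i j : ℕ) : 0 ≤ offKernel c r i j := by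
  unfold offKernel; split_ifs <;> positivity

lemma offKernel_comm (i j : ℕ) : offKernel c r i j = offKernel c r j i := by
  unfold offKernel; rw [dist_comm]; simp only [eq_comm]

lemma kernel_eq (i j : ℕ) : kernel c r i j = (if i = j then 1 else 0) + offKernel c r i j := by
  unfold kernel offKernel; split_ifs <;> simp

lemma offKernel_row (hc : 0 ≤ c) (h0 : 0 ≤ r) (h1 : r < 1) (S : Finset ℕ) (i : ℕ) :
    ∑ j ∈ S, offKernel c r i j ≤ 2 * c * (r / (1 - r)) := by
  set N := max (S.sup id + 1) (i + 1)
  have hsub : S ⊆ Finset.range i ∪ ({i} ∪ Finset.Ico (i + 1) N) := by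
    intro j hj
    have : j ≤ S.sup id := Finset.le_sup (f := id) hj
    simp only [Finset.mem_union, Finset.mem_range, Finset.mem_singleton, Finset.mem_Ico]
    omega
  have hlow : ∑ j ∈ Finset.range i, offKernel c r i j ≤ c * (r / (1 - r)) := by
    rw [← Finset.sum_range_reflect]
    calc _ = ∑ m ∈ Finset.range i, c * r ^ (m + 1) := by
          refine Finset.sum_congr rfl fun m hm => ?_
          rw [Finset.mem_range] at hm
          unfold offKernel dist
          rw [if_neg (by omega)]
          congr 2; omega
      _ ≤ _ := by rw [← Finset.mul_sum]; exact mul_le_mul_of_nonneg_left (geom_sum_le r h0 h1 i) hc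
  have hhigh : ∑ j ∈ Finset.Ico (i + 1) N, offKernel c r i j ≤ c * (r / (1 - r)) := by
    rw [Finset.sum_Ico_eq_sum_range]
    calc _ = ∑ m ∈ Finset.range (N - (i + 1)), c * r ^ (m + 1) := by
          refine Finset.sum_congr rfl fun m hm => ?_
          unfold offKernel dist
          rw [if_neg (by omega)]
          congr 2; omega
      _ ≤ _ := by rw [← Finset.mul_sum]; exact mul_le_mul_of_nonneg_left (geom_sum_le r h0 h1 _) hc
  calc _ ≤ ∑ j ∈ Finset.range i ∪ ({i} ∪ Finset.Ico (i + 1) N), offKernel c r i j :=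
        Finset.sum_le_sum_of_subset_of_nonneg hsub fun _ _ _ => offKernel_nonneg hc h0 _ _
    _ = ∑ j ∈ Finset.range i, offKernel c r i j + (0 +
          ∑ j ∈ Finset.Ico (i + 1) N, offKernel c r i j) := by
        rw [Finset.sum_union, Finset.sum_union]
        · simp [offKernel]
        · simp
        · rw [Finset.disjoint_left]; intro j; simp; omega
    _ ≤ _ := by linarith

lemma offKernel_schur (hc : 0 ≤ c) (h0 : 0 ≤ r) (h1 : r < 1) (S : Finset ℕ) (α β : ℕ → ℝ)
    (hα : ∀ i ∈ S, 0 ≤ α i) (hβ : ∀ i ∈ S, 0 ≤ β i) (q : ℝ) (hq : 1 / 2 ≤ q) :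
    ∑ i ∈ S, ∑ j ∈ S, offKernel c r i j * (α i * β j) ^ q ≤
      2 * c * (r / (1 - r)) * ((∑ i ∈ S, α i) * ∑ j ∈ S, β j) ^ q := by
  have h2 : 0 < 1 - r := by linarith
  refine schur_test S _ _ (by positivity) (offKernel_nonneg hc h0)
    (fun i _ => offKernel_row hc h0 h1 S i) (fun j _ => ?_) α β hα hβ q hq
  simp_rw [offKernel_comm (c := c) (r := r) _ j]
  exact offKernel_row hc h0 h1 S j

lemma diagonal_schur (S : Finset ℕ) (α β : ℕ → ℝ)
    (hα : ∀ i ∈ S, 0 ≤ α i) (hβ : ∀ i ∈ S, 0 ≤ β i) (q : ℝ) (hq : 1 / 2 ≤ q) :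
    ∑ i ∈ S, (α i * β i) ^ q ≤ ((∑ i ∈ S, α i) * ∑ j ∈ S, β j) ^ q := by
  have h := schur_test S (fun i j => if i = j then 1 else 0) 1 zero_le_one
    (fun i j => by split_ifs <;> simp) (fun i hi => by simp [hi])
    (fun i hi => by simp [hi]) α β hα hβ q hq
  rw [one_mul] at h
  refine le_trans (le_of_eq (Finset.sum_congr rfl fun i hi => ?_)) h
  simp [ite_mul, hi]

lemma kernel_schur (hc : 0 ≤ c) (h0 : 0 ≤ r) (h1 : r < 1) (S : Finset ℕ) (α β : ℕ → ℝ)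
    (hα : ∀ i ∈ S, 0 ≤ α i) (hβ : ∀ i ∈ S, 0 ≤ β i) (q : ℝ) (hq : 1 / 2 ≤ q) :
    ∑ i ∈ S, ∑ j ∈ S, kernel c r i j * (α i * β j) ^ q ≤
      (1 + 2 * c * (r / (1 - r))) * ((∑ i ∈ S, α i) * ∑ j ∈ S, β j) ^ q := by
  have h := offKernel_schur hc h0 h1 S α β hα hβ q hq
  have h' := diagonal_schur S α β hα hβ q hq
  simp_rw [kernel_eq, add_mul, Finset.sum_add_distrib]
  have e : ∑ i ∈ S, ∑ j ∈ S, (if i = j then (1 : ℝ) else 0) * (α i * β j) ^ q =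
      ∑ i ∈ S, (α i * β i) ^ q :=
    Finset.sum_congr rfl fun i hi => by simp [ite_mul, hi]
  rw [e]
  linarith

lemma le_of_bootstrap {ε q η x x₀ : ℝ} (hε : 0 < ε) (hε' : ε ≤ 4 / 5) (hq : q = (1 + ε) / 2)
    (hη0 : 0 ≤ η) (hx₀ε : 8 * x₀ ^ ε ≤ 1) (hx0 : 0 ≤ x) (hxx₀ : x ≤ x₀)
    (hineq : x / 2 < 2 * η * x ^ q + 2 * x ^ (1 + ε)) : x ≤ (8 * η) ^ (1 / (1 - q)) := by
  have hq1 : 0 < 1 - q := by linarith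
  rcases hx0.eq_or_lt with h | hxpos
  · rw [← h]; positivity
  · have h2 : x ^ (1 + ε) = x * x ^ ε := by rw [Real.rpow_add hxpos, Real.rpow_one]
    have h3 : x ^ ε ≤ x₀ ^ ε := Real.rpow_le_rpow hx0 hxx₀ hε.le
    have h4 : x ^ q * x ^ (1 - q) = x := by rw [← Real.rpow_add hxpos]; simp
    have h5 : 0 < x ^ q := Real.rpow_pos_of_pos hxpos _
    have h6 : x ^ (1 - q) ≤ 8 * η := by
      have h7 : x * x ^ ε ≤ x * (1 / 8) := mul_le_mul_of_nonneg_left (by linarith) hx0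
      have h8 : x ^ q * x ^ (1 - q) ≤ x ^ q * (8 * η) := by rw [h4]; linarith
      exact le_of_mul_le_mul_left h8 h5
    calc x = (x ^ (1 - q)) ^ (1 / (1 - q)) := by
          rw [← Real.rpow_mul hx0, mul_one_div_cancel hq1.ne', Real.rpow_one]
      _ ≤ _ := Real.rpow_le_rpow (by positivity) h6 (by positivity)

/-- Bounding `(α i * β i) ^ q` by `(max (α i * β i)) ^ (ε / 2) * (α i * β i) ^ (1 / 2)` shows that the
maximal product is close to `1`. -/
lemma lt_max_product {ε q η x₀ : ℝ} (hε : 0 < ε) (hq : q = (1 + ε) / 2)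
    (hc : 0 ≤ c) (h0 : 0 ≤ r) (h1 : r < 1) (hη : 2 * c * (r / (1 - r)) ≤ η)
    (hηx : (1 - x₀) ^ (ε / 2) ≤ 1 - η)
    (S : Finset ℕ) (α β : ℕ → ℝ) (hα : ∀ i ∈ S, 0 ≤ α i) (hβ : ∀ i ∈ S, 0 ≤ β i)
    (hα1 : ∑ i ∈ S, α i = 1) (hβ1 : ∑ i ∈ S, β i = 1)
    (hbig : 1 < ∑ i ∈ S, ∑ j ∈ S, kernel c r i j * (α i * β j) ^ q) {k : ℕ} (hk : k ∈ S)
    (hmax : ∀ i ∈ S, α i * β i ≤ α k * β k) : 1 - x₀ < α k * β k := by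
  by_contra! hcon
  have hq2 : 1 / 2 ≤ q := by linarith
  have hk0 : 0 ≤ α k * β k := mul_nonneg (hα k hk) (hβ k hk)
  have hd : ∑ i ∈ S, (α i * β i) ^ q ≤ (α k * β k) ^ (ε / 2) := by
    have hd2 := diagonal_schur S α β hα hβ (1 / 2) le_rfl
    rw [hα1, hβ1, mul_one, Real.one_rpow] at hd2
    calc ∑ i ∈ S, (α i * β i) ^ q ≤
        ∑ i ∈ S, (α k * β k) ^ (ε / 2) * (α i * β i) ^ (1 / 2 : ℝ) := by
          refine Finset.sum_le_sum fun i hi => ?_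
          have hi0 : 0 ≤ α i * β i := mul_nonneg (hα i hi) (hβ i hi)
          have e : q = ε / 2 + 1 / 2 := by rw [hq]; ring
          rw [e, Real.rpow_add_of_nonneg hi0 (by linarith) (by norm_num)]
          exact mul_le_mul_of_nonneg_right
            (Real.rpow_le_rpow hi0 (hmax i hi) (by linarith)) (Real.rpow_nonneg hi0 _)
      _ = (α k * β k) ^ (ε / 2) * ∑ i ∈ S, (α i * β i) ^ (1 / 2 : ℝ) := by rw [Finset.mul_sum]
      _ ≤ (α k * β k) ^ (ε / 2) * 1 :=
          mul_le_mul_of_nonneg_left hd2 (Real.rpow_nonneg hk0 _)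
      _ = _ := mul_one _
  have ho := offKernel_schur hc h0 h1 S α β hα hβ q hq2
  rw [hα1, hβ1, mul_one, Real.one_rpow, mul_one] at ho
  have e : ∑ i ∈ S, ∑ j ∈ S, kernel c r i j * (α i * β j) ^ q = ∑ i ∈ S, (α i * β i) ^ q +
      ∑ i ∈ S, ∑ j ∈ S, offKernel c r i j * (α i * β j) ^ q := by
    simp_rw [kernel_eq, add_mul, Finset.sum_add_distrib]
    congr 1
    exact Finset.sum_congr rfl fun i hi => by simp [ite_mul, hi]
  have h3 : (α k * β k) ^ (ε / 2) ≤ (1 - x₀) ^ (ε / 2) :=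
    Real.rpow_le_rpow hk0 hcon (by linarith)
  linarith

/-- Two probability vectors for which the near-diagonal form exceeds `1` are concentrated at a
common index `k`, up to a mass `(8 η) ^ (1 / (1 - q))`, where `η` bounds the off-diagonal row sums.
Comparing `α ^ q` with `α ^ (1 / 2)` produces `k`; then the inequality
`1 ≤ (1 - x) ^ q + 2 η x ^ q + (1 + η) x ^ (2 q)` for the mass `x` away from `k` bootstraps the crude
bound `x ≤ x₀` to the sharp one. -/
lemma concentration {ε q η x₀ : ℝ} (hε : 0 < ε) (hε' : ε ≤ 4 / 5) (hq : q = (1 + ε) / 2)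
    (hc : 0 ≤ c) (h0 : 0 ≤ r) (h1 : r < 1) (hη : 2 * c * (r / (1 - r)) ≤ η) (hη1 : η ≤ 1)
    (hx₀1 : x₀ ≤ 1) (hx₀ε : 8 * x₀ ^ ε ≤ 1) (hηx : (1 - x₀) ^ (ε / 2) ≤ 1 - η)
    (S : Finset ℕ) (α β : ℕ → ℝ) (hα : ∀ i ∈ S, 0 ≤ α i) (hβ : ∀ i ∈ S, 0 ≤ β i)
    (hα1 : ∑ i ∈ S, α i = 1) (hβ1 : ∑ i ∈ S, β i = 1)
    (hbig : 1 < ∑ i ∈ S, ∑ j ∈ S, kernel c r i j * (α i * β j) ^ q) :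
    ∃ k ∈ S, ∑ i ∈ S.erase k, ∑ j ∈ S.erase k, kernel c r i j * (α i * β j) ^ q ≤
      2 * ((8 * η) ^ (1 / (1 - q))) ^ (1 + ε) := by
  have hr1 : 0 < 1 - r := by linarith
  have hη0 : 0 ≤ η := le_trans (by positivity) hη
  have hq2 : 1 / 2 ≤ q := by linarith
  have hq0 : 0 ≤ q := by linarith
  have hSne : S.Nonempty := by
    rw [Finset.nonempty_iff_ne_empty]; rintro rfl; simp at hα1
  obtain ⟨k, hk, hmax⟩ := Finset.exists_max_image S (fun i => α i * β i) hSne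
  refine ⟨k, hk, ?_⟩
  have hαk := hα k hk
  have hβk := hβ k hk
  have hαk1 : α k ≤ 1 := hα1 ▸ Finset.single_le_sum hα hk
  have hβk1 : β k ≤ 1 := hβ1 ▸ Finset.single_le_sum hβ hk
  have hy : 1 - x₀ < α k * β k :=
    lt_max_product hε hq hc h0 h1 hη hηx S α β hα hβ hα1 hβ1 hbig hk hmax
  set δ := ∑ i ∈ S.erase k, α i with hδ
  set δ' := ∑ i ∈ S.erase k, β i with hδ'
  have hδk : α k + δ = 1 := by rw [hδ, Finset.add_sum_erase S α hk, hα1]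
  have hδk' : β k + δ' = 1 := by rw [hδ', Finset.add_sum_erase S β hk, hβ1]
  have hαe : ∀ i ∈ S.erase k, 0 ≤ α i := fun i hi => hα i (Finset.mem_of_mem_erase hi)
  have hβe : ∀ i ∈ S.erase k, 0 ≤ β i := fun i hi => hβ i (Finset.mem_of_mem_erase hi)
  have hδ0 : 0 ≤ δ := Finset.sum_nonneg hαe
  have hδ0' : 0 ≤ δ' := Finset.sum_nonneg hβe
  set x := max δ δ' with hx
  have hδx : δ ≤ x := le_max_left _ _
  have hδx' : δ' ≤ x := le_max_right _ _
  have hx0 : 0 ≤ x := hδ0.trans hδx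
  have hxx₀ : x ≤ x₀ := by
    apply max_le <;> nlinarith
  have hx1 : x ≤ 1 := hxx₀.trans hx₀1
  -- The four parts of the form cut out by the index `k`.
  have hbad : ∑ i ∈ S.erase k, ∑ j ∈ S.erase k, kernel c r i j * (α i * β j) ^ q ≤
      2 * x ^ (1 + ε) := by
    have h := kernel_schur hc h0 h1 (S.erase k) α β hαe hβe q hq2
    refine h.trans ?_
    have e : x ^ (1 + ε) = (x * x) ^ q := by
      rw [← sq, ← Real.rpow_natCast x 2, ← Real.rpow_mul hx0]
      congr 1; rw [hq]; push_cast; ring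
    rw [e]
    have : (δ * δ') ^ q ≤ (x * x) ^ q :=
      Real.rpow_le_rpow (by positivity) (mul_le_mul hδx hδx' hδ0' hx0) hq0
    exact mul_le_mul (by linarith) this (by positivity) (by norm_num)
  have hrow : ∑ j ∈ S.erase k, kernel c r k j * (α k * β j) ^ q ≤ η * x ^ q := by
    calc _ ≤ ∑ j ∈ S.erase k, offKernel c r k j * x ^ q := by
          refine Finset.sum_le_sum fun j hj => ?_
          have hjk : k ≠ j := (Finset.ne_of_mem_erase hj).symm
          have e : kernel c r k j = offKernel c r k j := by simp [kernel, offKernel, hjk]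
          rw [e]
          have hb : β j ≤ δ' := Finset.single_le_sum hβe hj
          have hb0 := hβe j hj
          refine mul_le_mul_of_nonneg_left ?_ (offKernel_nonneg hc h0 _ _)
          exact Real.rpow_le_rpow (mul_nonneg hαk hb0) (by nlinarith) hq0
      _ = (∑ j ∈ S.erase k, offKernel c r k j) * x ^ q := by rw [Finset.sum_mul]
      _ ≤ _ := mul_le_mul_of_nonneg_right ((offKernel_row hc h0 h1 _ k).trans hη) (by positivity)
  have hcol : ∑ i ∈ S.erase k, kernel c r i k * (α i * β k) ^ q ≤ η * x ^ q := by
    calc _ ≤ ∑ i ∈ S.erase k, offKernel c r k i * x ^ q := by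
          refine Finset.sum_le_sum fun j hj => ?_
          have hjk : j ≠ k := Finset.ne_of_mem_erase hj
          have e : kernel c r j k = offKernel c r k j := by
            rw [offKernel_comm]; simp [kernel, offKernel, hjk]
          rw [e]
          have hb : α j ≤ δ := Finset.single_le_sum hαe hj
          have hb0 := hαe j hj
          refine mul_le_mul_of_nonneg_left ?_ (offKernel_nonneg hc h0 _ _)
          exact Real.rpow_le_rpow (mul_nonneg hb0 hβk) (by nlinarith) hq0
      _ = (∑ j ∈ S.erase k, offKernel c r k j) * x ^ q := by rw [Finset.sum_mul]
      _ ≤ _ := mul_le_mul_of_nonneg_right ((offKernel_row hc h0 h1 _ k).trans hη) (by positivity)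
  have hkk : kernel c r k k * (α k * β k) ^ q ≤ 1 - x / 2 := by
    have h2 : α k * β k ≤ 1 - x := by
      have : x ≤ 1 - α k * β k := max_le (by nlinarith) (by nlinarith)
      linarith
    have h3 : (1 + -x) ^ q ≤ 1 + q * -x :=
      rpow_one_add_le_one_add_mul_self (by linarith) hq0 (by linarith)
    have h4 : (α k * β k) ^ q ≤ (1 + -x) ^ q :=
      Real.rpow_le_rpow (by positivity) (by linarith) hq0
    have h5 : 1 / 2 * x ≤ q * x := mul_le_mul_of_nonneg_right hq2 hx0
    simp only [kernel, if_true, one_mul]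
    linarith
  have hsplit : ∑ i ∈ S, ∑ j ∈ S, kernel c r i j * (α i * β j) ^ q =
      kernel c r k k * (α k * β k) ^ q + ∑ j ∈ S.erase k, kernel c r k j * (α k * β j) ^ q +
      (∑ i ∈ S.erase k, kernel c r i k * (α i * β k) ^ q +
        ∑ i ∈ S.erase k, ∑ j ∈ S.erase k, kernel c r i j * (α i * β j) ^ q) := by
    rw [← Finset.add_sum_erase S _ hk, ← Finset.add_sum_erase S _ hk, ← Finset.sum_add_distrib]
    congr 1
    refine Finset.sum_congr rfl fun i _ => ?_
    rw [← Finset.add_sum_erase S _ hk]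
  have hineq : x / 2 < 2 * η * x ^ q + 2 * x ^ (1 + ε) := by linarith
  have hxx : x ≤ (8 * η) ^ (1 / (1 - q)) :=
    le_of_bootstrap hε hε' hq hη0 hx₀ε hx0 hxx₀ hineq
  refine hbad.trans ?_
  exact mul_le_mul_of_nonneg_left (Real.rpow_le_rpow hx0 hxx (by linarith)) (by norm_num)

end kernel

/-! ### Removing one prime -/

/-- The local factor `φ(p ^ k) / p ^ k` of `φ(v) / v` at a prime `p`. -/
noncomputable def density (p k : ℕ) : ℝ := if k = 0 then 1 else 1 - 1 / (p : ℝ)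

/-- The weight `φ(v') / v' * x v`, where `v'` is the part of `v` composed of the primes in `P`. -/
noncomputable def wt (P : Finset ℕ) (x : ℕ → ℝ) (v : ℕ) : ℝ := (∏ p ∈ P, density p (v.factorization p)) * x v

/-- The total weight of a finite set of integers. -/
noncomputable def mass (P : Finset ℕ) (x : ℕ → ℝ) (I : Finset ℕ) : ℝ := ∑ v ∈ I, wt P x v

/-- The number of primes `p ≤ t` in `P` at which `v` and `w` have different valuations. -/
noncomputable def omegaOn (P : Finset ℕ) (t : ℝ) (v w : ℕ) : ℕ :=
  (P.filter fun p : ℕ => (p : ℝ) ≤ t ∧ v.factorization p ≠ w.factorization p).card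

/-- The quotient `v' / gcd(v', w')`, where `v'` and `w'` are the parts of `v` and `w` composed of the
primes in `P`. The difference of the valuations is truncated. -/
noncomputable def excess (P : Finset ℕ) (v w : ℕ) : ℝ :=
  ∏ p ∈ P, (p : ℝ) ^ (v.factorization p - w.factorization p)

/-- The analogue of `pairSet` that only looks at the primes in `P`, for weights `x` and `y` on the
finite sets `I` and `J`. -/
noncomputable def edges (P : Finset ℕ) (t K : ℝ) (x y : ℕ → ℝ) (I J : Finset ℕ) : Finset (ℕ × ℕ) :=
  {z ∈ I ×ˢ J | x z.1 * excess P z.2 z.1 ≤ 1 ∧ y z.2 * excess P z.1 z.2 ≤ 1 ∧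
    K ≤ (omegaOn P t z.1 z.2 : ℝ)}

/-- The total weight of a finite set of pairs of integers. -/
noncomputable def pairMass (P : Finset ℕ) (x y : ℕ → ℝ) (E : Finset (ℕ × ℕ)) : ℝ :=
  ∑ z ∈ E, wt P x z.1 * wt P y z.2

/-- The elements of `I` are determined by their valuations at the primes in `P`. -/
def Separated (P I : Finset ℕ) : Prop :=
  ∀ v ∈ I, ∀ w ∈ I, (∀ p ∈ P, v.factorization p = w.factorization p) → v = w

/-- The bound to be proved, with the constant `T`, for all systems of integers seen through the
primes in `P`. Removing a prime from `P` rescales the weights but leaves the integers as they are,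
which is why the weights are arbitrary and the integers need not be composed of primes in `P`. -/
def Bound (P : Finset ℕ) (t ε C T : ℝ) : Prop :=
  ∀ (I J : Finset ℕ) (x y : ℕ → ℝ) (K : ℝ), Separated P I → Separated P J →
    (∀ v ∈ I, 0 < x v) → (∀ w ∈ J, 0 < y w) →
    pairMass P x y (edges P t K x y I J) ≤
      T * Real.exp (-(C * K * (1 + ε))) * (mass P x I * mass P y J) ^ ((1 + ε) / 2)

lemma density_pos {p : ℕ} (hp : p.Prime) (k : ℕ) : 0 < density p k := by
  unfold density
  have h : (1 : ℝ) < p := by exact_mod_cast hp.one_lt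
  split_ifs
  · exact one_pos
  · have : 1 / (p : ℝ) < 1 := by rw [div_lt_one (by linarith)]; exact h
    linarith

lemma density_le_one (p k : ℕ) : density p k ≤ 1 := by
  unfold density
  split_ifs
  · exact le_rfl
  · have : 0 ≤ 1 / (p : ℝ) := by positivity
    linarith

lemma wt_pos {P : Finset ℕ} (hP : ∀ p ∈ P, p.Prime) {x : ℕ → ℝ} {v : ℕ} (hx : 0 < x v) :
    0 < wt P x v := mul_pos (Finset.prod_pos fun p hp => density_pos (hP p hp) _) hx

lemma mass_nonneg {P : Finset ℕ} (hP : ∀ p ∈ P, p.Prime) {x : ℕ → ℝ} {I : Finset ℕ}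
    (hx : ∀ v ∈ I, 0 < x v) : 0 ≤ mass P x I :=
  Finset.sum_nonneg fun v hv => (wt_pos hP (hx v hv)).le

lemma sum_mass_fiber (P : Finset ℕ) (x : ℕ → ℝ) (I : Finset ℕ) (f : ℕ → ℕ) (S : Finset ℕ)
    (h : ∀ v ∈ I, f v ∈ S) : ∑ i ∈ S, mass P x (I.filter fun v => f v = i) = mass P x I :=
  Finset.sum_fiberwise_of_maps_to h _

lemma sum_pairMass_fiber (P : Finset ℕ) (x y : ℕ → ℝ) (E : Finset (ℕ × ℕ)) (f : ℕ → ℕ)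
    (A B : Finset ℕ) (h : ∀ z ∈ E, f z.1 ∈ A ∧ f z.2 ∈ B) :
    pairMass P x y E =
      ∑ i ∈ A, ∑ j ∈ B, pairMass P x y (E.filter fun z => f z.1 = i ∧ f z.2 = j) := by
  rw [← Finset.sum_product']
  unfold pairMass
  rw [← Finset.sum_fiberwise_of_maps_to (g := fun z : ℕ × ℕ => (f z.1, f z.2)) (t := A ×ˢ B)
    (fun z hz => Finset.mem_product.2 (h z hz))]
  refine Finset.sum_congr rfl fun ij _ => Finset.sum_congr ?_ fun _ _ => rfl
  ext z
  simp [Prod.ext_iff]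

lemma pairMass_mono {P : Finset ℕ} {x y : ℕ → ℝ} {E F : Finset (ℕ × ℕ)}
    (h : E ⊆ F) (hF : ∀ z ∈ F, 0 ≤ wt P x z.1 * wt P y z.2) : pairMass P x y E ≤ pairMass P x y F :=
  Finset.sum_le_sum_of_subset_of_nonneg h fun z hz _ => hF z hz

lemma excess_eq {P : Finset ℕ} {p : ℕ} (hp : p ∈ P) (v w : ℕ) :
    excess P v w = (p : ℝ) ^ (v.factorization p - w.factorization p) * excess (P.erase p) v w :=
  (Finset.mul_prod_erase P _ hp).symm

lemma wt_eq {P : Finset ℕ} {p : ℕ} (hp : p ∈ P) (x : ℕ → ℝ) (v : ℕ) :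
    wt P x v = density p (v.factorization p) * wt (P.erase p) x v := by
  unfold wt
  rw [← Finset.mul_prod_erase P _ hp]; ring

lemma wt_smul (P : Finset ℕ) (a : ℝ) (x : ℕ → ℝ) (v : ℕ) :
    wt P (fun u => a * x u) v = a * wt P x v := by unfold wt; ring

lemma omegaOn_le (P : Finset ℕ) (p : ℕ) (t : ℝ) (v w : ℕ) :
    omegaOn P t v w ≤ omegaOn (P.erase p) t v w +
      if v.factorization p = w.factorization p then 0 else 1 := by
  unfold omegaOn
  rw [Finset.filter_erase]
  split_ifs with h
  · rw [Finset.erase_eq_of_notMem]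
    · simp
    · simp [h]
  · have := Finset.pred_card_le_card_erase
      (s := P.filter fun p : ℕ => (p : ℝ) ≤ t ∧ v.factorization p ≠ w.factorization p) (a := p)
    omega

lemma Separated.filter_erase {P I : Finset ℕ} (h : Separated P I) (p i : ℕ) :
    Separated (P.erase p) (I.filter fun v => v.factorization p = i) := by
  intro v hv w hw hvw
  rw [Finset.mem_filter] at hv hw
  refine h v hv.1 w hw.1 fun r hr => ?_
  by_cases hrp : r = p
  · rw [hrp, hv.2, hw.2]
  · exact hvw r (Finset.mem_erase.2 ⟨hrp, hr⟩)

/-- The pairs with valuations `i` and `j` at `p` form a system in which `p` plays no role, once the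
weights are multiplied by `p ^ (j - i)` and `p ^ (i - j)` (truncated). -/
lemma pairMass_fiber_le {P : Finset ℕ} (hP : ∀ p ∈ P, p.Prime) {p : ℕ} (hp : p ∈ P)
    {t ε C T q r : ℝ} (hε : 0 < ε) (hε' : ε ≤ 4 / 5) (hC : 0 < C) (hT : 0 ≤ T)
    (hq : q = (1 + ε) / 2) (hr : r = (p : ℝ) ^ (-(1 - q)))
    (hB : Bound (P.erase p) t ε C T) (I J : Finset ℕ) (x y : ℕ → ℝ) (K : ℝ)
    (hI : Separated P I) (hJ : Separated P J) (hx : ∀ v ∈ I, 0 < x v) (hy : ∀ w ∈ J, 0 < y w)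
    (i j : ℕ) :
    pairMass P x y ((edges P t K x y I J).filter
        fun z => z.1.factorization p = i ∧ z.2.factorization p = j) ≤
      T * Real.exp (-(C * K * (1 + ε))) * (kernel (Real.exp (2 * C)) r i j *
        (mass P x (I.filter fun v => v.factorization p = i) *
          mass P y (J.filter fun w => w.factorization p = j)) ^ q) := by
  have hpp := hP p hp
  have hp1 : (1 : ℝ) ≤ p := by exact_mod_cast hpp.one_lt.le
  have hp0 : (0 : ℝ) < p := by linarith
  set P' := P.erase p with hP'
  have hP'p : ∀ p ∈ P', p.Prime := fun p hp => hP p (Finset.mem_of_mem_erase hp)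
  set Ii := I.filter fun v => v.factorization p = i with hIi
  set Jj := J.filter fun w => w.factorization p = j with hJj
  set x' : ℕ → ℝ := fun v => (p : ℝ) ^ (j - i) * x v with hx'
  set y' : ℕ → ℝ := fun v => (p : ℝ) ^ (i - j) * y v with hy'
  set K' : ℝ := K - (if i = j then 0 else 1) with hK'
  set z₁ : ℝ := density p i / (p : ℝ) ^ (j - i) with hz₁
  set z₂ : ℝ := density p j / (p : ℝ) ^ (i - j) with hz₂
  have hd1 := density_pos hpp i
  have hd2 := density_pos hpp j
  have hz₁0 : 0 < z₁ := by positivity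
  have hz₂0 : 0 < z₂ := by positivity
  have hx0' : ∀ v ∈ Ii, 0 < x' v := fun v hv =>
    mul_pos (by positivity) (hx v (Finset.mem_filter.1 hv).1)
  have hy0' : ∀ v ∈ Jj, 0 < y' v := fun v hv =>
    mul_pos (by positivity) (hy v (Finset.mem_filter.1 hv).1)
  have hw₁ : ∀ v ∈ Ii, wt P x v = z₁ * wt P' x' v := by
    intro v hv
    rw [wt_eq hp, ← hP', (Finset.mem_filter.1 hv).2, hx', wt_smul, hz₁]
    field_simp
  have hw₂ : ∀ v ∈ Jj, wt P y v = z₂ * wt P' y' v := by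
    intro v hv
    rw [wt_eq hp, ← hP', (Finset.mem_filter.1 hv).2, hy', wt_smul, hz₂]
    field_simp
  have hm₁ : mass P x Ii = z₁ * mass P' x' Ii := by
    unfold mass; rw [Finset.mul_sum]; exact Finset.sum_congr rfl hw₁
  have hm₂ : mass P y Jj = z₂ * mass P' y' Jj := by
    unfold mass; rw [Finset.mul_sum]; exact Finset.sum_congr rfl hw₂
  have hm₁0 : 0 ≤ mass P' x' Ii := mass_nonneg hP'p hx0'
  have hm₂0 : 0 ≤ mass P' y' Jj := mass_nonneg hP'p hy0'
  have hmem : ∀ z ∈ edges P' t K' x' y' Ii Jj, z.1 ∈ Ii ∧ z.2 ∈ Jj := fun z hz =>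
    Finset.mem_product.1 (Finset.mem_filter.1 hz).1
  have hsub : (edges P t K x y I J).filter
      (fun z => z.1.factorization p = i ∧ z.2.factorization p = j) ⊆ edges P' t K' x' y' Ii Jj := by
    rintro ⟨v, w⟩ hz
    simp only [edges, Finset.mem_filter, Finset.mem_product] at hz
    obtain ⟨⟨⟨hv, hw⟩, h1, h2, h3⟩, hvi, hwj⟩ := hz
    simp only [edges, Finset.mem_filter, Finset.mem_product, hIi, hJj]
    refine ⟨⟨⟨hv, hvi⟩, hw, hwj⟩, ?_, ?_, ?_⟩
    · rw [excess_eq hp, hvi, hwj] at h1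
      calc _ = x v * ((p : ℝ) ^ (j - i) * excess P' w v) := by simp only [hx']; ring
        _ ≤ 1 := h1
    · rw [excess_eq hp, hvi, hwj] at h2
      calc _ = y w * ((p : ℝ) ^ (i - j) * excess P' v w) := by simp only [hy']; ring
        _ ≤ 1 := h2
    · have h4 := omegaOn_le P p t v w
      rw [hvi, hwj] at h4
      have h5 : (omegaOn P t v w : ℝ) ≤ omegaOn P' t v w + (if i = j then 0 else 1) := by
        split_ifs at h4 ⊢ <;> exact_mod_cast h4
      linarith
  have hpm : pairMass P x y (edges P' t K' x' y' Ii Jj) =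
      z₁ * z₂ * pairMass P' x' y' (edges P' t K' x' y' Ii Jj) := by
    unfold pairMass
    rw [Finset.mul_sum]
    refine Finset.sum_congr rfl fun z hz => ?_
    rw [hw₁ _ (hmem z hz).1, hw₂ _ (hmem z hz).2]; ring
  have h1 : pairMass P x y ((edges P t K x y I J).filter
      fun z => z.1.factorization p = i ∧ z.2.factorization p = j) ≤
      z₁ * z₂ * (T * Real.exp (-(C * K' * (1 + ε))) * (mass P' x' Ii * mass P' y' Jj) ^ q) := by
    refine (pairMass_mono hsub fun z hz => ?_).trans ?_
    · have h1 := wt_pos hP (hx z.1 (Finset.mem_filter.1 (hmem z hz).1).1)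
      have h2 := wt_pos hP (hy z.2 (Finset.mem_filter.1 (hmem z hz).2).1)
      positivity
    · rw [hpm, hq]
      exact mul_le_mul_of_nonneg_left
        (hB Ii Jj x' y' K' (hI.filter_erase p i) (hJ.filter_erase p j) hx0' hy0') (by positivity)
  refine h1.trans ?_
  have hq0 : 0 ≤ 1 - q := by linarith
  have hz : (z₁ * z₂) = (z₁ * z₂) ^ (1 - q) * (z₁ * z₂) ^ q := by
    rw [← Real.rpow_add (by positivity)]; simp
  have hzle : z₁ * z₂ ≤ ((p : ℝ) ^ dist i j)⁻¹ := by
    have : z₁ * z₂ = density p i * density p j * ((p : ℝ) ^ dist i j)⁻¹ := by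
      rw [hz₁, hz₂, dist, pow_add]; field_simp
    rw [this]
    have h2 : density p i * density p j ≤ 1 :=
      mul_le_one₀ (density_le_one p i) hd2.le (density_le_one p j)
    exact mul_le_of_le_one_left (by positivity) h2
  have hzr : (z₁ * z₂) ^ (1 - q) ≤ r ^ dist i j := by
    refine (Real.rpow_le_rpow (by positivity) hzle hq0).trans (le_of_eq ?_)
    rw [hr, ← Real.rpow_natCast (_ ^ _) (dist i j), ← Real.rpow_natCast (p : ℝ) (dist i j),
      ← Real.rpow_neg hp0.le, ← Real.rpow_mul hp0.le, ← Real.rpow_mul hp0.le]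
    congr 1; ring
  have hr0 : 0 < r := by rw [hr]; positivity
  have hexp : (z₁ * z₂) ^ (1 - q) * Real.exp (-(C * K' * (1 + ε))) ≤
      Real.exp (-(C * K * (1 + ε))) * kernel (Real.exp (2 * C)) r i j := by
    unfold kernel
    by_cases hij : i = j
    · rw [if_pos hij, mul_one, hK', if_pos hij, sub_zero]
      have : dist i j = 0 := by unfold dist; omega
      rw [this, pow_zero] at hzr
      exact mul_le_of_le_one_left (Real.exp_pos _).le hzr
    · rw [if_neg hij, hK', if_neg hij]
      have e : Real.exp (-(C * (K - 1) * (1 + ε))) =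
          Real.exp (-(C * K * (1 + ε))) * Real.exp (C * (1 + ε)) := by
        rw [← Real.exp_add]; congr 1; ring
      have h3 : Real.exp (C * (1 + ε)) ≤ Real.exp (2 * C) := Real.exp_le_exp.2 (by nlinarith)
      rw [e]
      calc _ ≤ r ^ dist i j * (Real.exp (-(C * K * (1 + ε))) * Real.exp (2 * C)) := by gcongr
        _ = _ := by ring
  rw [hm₁, hm₂]
  have e : (z₁ * mass P' x' Ii * (z₂ * mass P' y' Jj)) ^ q =
      (z₁ * z₂) ^ q * (mass P' x' Ii * mass P' y' Jj) ^ q := by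
    rw [← Real.mul_rpow (by positivity) (by positivity)]; congr 1; ring
  rw [e]
  calc _ = T * ((z₁ * z₂) ^ (1 - q) * Real.exp (-(C * K' * (1 + ε)))) *
        ((z₁ * z₂) ^ q * (mass P' x' Ii * mass P' y' Jj) ^ q) := by
        nth_rewrite 1 [hz]; ring
    _ ≤ T * (Real.exp (-(C * K * (1 + ε))) * kernel (Real.exp (2 * C)) r i j) *
        ((z₁ * z₂) ^ q * (mass P' x' Ii * mass P' y' Jj) ^ q) := by gcongr
    _ = _ := by ring

lemma edges_factorization_mem {P I J : Finset ℕ} {t K : ℝ} {x y : ℕ → ℝ} (p : ℕ) {z : ℕ × ℕ}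
    (hz : z ∈ edges P t K x y I J) :
    z.1.factorization p ∈ (I ∪ J).image (fun v => v.factorization p) ∧
      z.2.factorization p ∈ (I ∪ J).image (fun v => v.factorization p) := by
  obtain ⟨h1, h2⟩ := Finset.mem_product.1 (Finset.mem_filter.1 hz).1
  exact ⟨Finset.mem_image_of_mem (fun v => v.factorization p) (Finset.mem_union_left _ h1),
    Finset.mem_image_of_mem (fun v => v.factorization p) (Finset.mem_union_right _ h2)⟩

/-- Adding one prime costs at most a constant factor. -/
lemma Bound.of_erase {P : Finset ℕ} (hP : ∀ p ∈ P, p.Prime) {p : ℕ} (hp : p ∈ P)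
    {t ε C T q r b : ℝ} (hε : 0 < ε) (hε' : ε ≤ 4 / 5) (hC : 0 < C) (hT : 0 ≤ T)
    (hq : q = (1 + ε) / 2) (hr : r = (p : ℝ) ^ (-(1 - q))) (hr1 : r < 1)
    (hb : 1 + 2 * Real.exp (2 * C) * (r / (1 - r)) ≤ b)
    (hB : Bound (P.erase p) t ε C T) : Bound P t ε C (b * T) := by
  intro I J x y K hI hJ hx hy
  set S := (I ∪ J).image (fun v => v.factorization p) with hS
  set α : ℕ → ℝ := fun i => mass P x (I.filter fun v => v.factorization p = i) with hα
  set β : ℕ → ℝ := fun i => mass P y (J.filter fun v => v.factorization p = i) with hβ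
  have hr0 : 0 ≤ r := by rw [hr]; positivity
  have hα0 : ∀ i, 0 ≤ α i := fun i => mass_nonneg hP fun v hv => hx v (Finset.mem_filter.1 hv).1
  have hβ0 : ∀ i, 0 ≤ β i := fun i => mass_nonneg hP fun v hv => hy v (Finset.mem_filter.1 hv).1
  have hαs : ∑ i ∈ S, α i = mass P x I := sum_mass_fiber P x I _ S fun v hv =>
    Finset.mem_image_of_mem (fun v => v.factorization p) (Finset.mem_union_left _ hv)
  have hβs : ∑ i ∈ S, β i = mass P y J := sum_mass_fiber P y J _ S fun v hv =>
    Finset.mem_image_of_mem (fun v => v.factorization p) (Finset.mem_union_right _ hv)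
  have hk := kernel_schur (Real.exp_pos (2 * C)).le hr0 hr1 S α β (fun i _ => hα0 i)
    (fun i _ => hβ0 i) q (by linarith)
  rw [hαs, hβs] at hk
  rw [sum_pairMass_fiber P x y _ (fun v => v.factorization p) S S
    fun z hz => edges_factorization_mem p hz]
  set X := (mass P x I * mass P y J) ^ q with hX
  have hX0 : 0 ≤ X := Real.rpow_nonneg (mul_nonneg (mass_nonneg hP hx) (mass_nonneg hP hy)) _
  calc _ ≤ ∑ i ∈ S, ∑ j ∈ S, T * Real.exp (-(C * K * (1 + ε))) *
        (kernel (Real.exp (2 * C)) r i j * (α i * β j) ^ q) :=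
        Finset.sum_le_sum fun i _ => Finset.sum_le_sum fun j _ =>
          pairMass_fiber_le hP hp hε hε' hC hT hq hr hB I J x y K hI hJ hx hy i j
    _ = T * Real.exp (-(C * K * (1 + ε))) * ∑ i ∈ S, ∑ j ∈ S,
        (kernel (Real.exp (2 * C)) r i j * (α i * β j) ^ q) := by simp_rw [Finset.mul_sum]
    _ ≤ T * Real.exp (-(C * K * (1 + ε))) * (b * X) := by
        refine mul_le_mul_of_nonneg_left (hk.trans ?_) (by positivity)
        exact mul_le_mul_of_nonneg_right hb hX0
    _ = _ := by rw [hX, hq]; ring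

/-- If adding the prime `p` breaks the bound for some system, then in that system almost all of the
weight sits at a single valuation `k`, so that few pairs avoid `k` on both sides. The factor on the
right is `O((8 η) ^ ((1 + ε) / (1 - q)))`, that is `O(p ^ (-(1 + ε)))` when `η` is of order `r`: the two
exceptional masses are `O(1 / p)` each and enter with the exponent `q > 1 / 2`. -/
lemma exists_concentration {P : Finset ℕ} (hP : ∀ p ∈ P, p.Prime) {p : ℕ} (hp : p ∈ P)
    {t ε C T q r η x₀ : ℝ} (hε : 0 < ε) (hε' : ε ≤ 4 / 5) (hC : 0 < C) (hT : 0 < T)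
    (hq : q = (1 + ε) / 2) (hr : r = (p : ℝ) ^ (-(1 - q))) (hr1 : r < 1)
    (hη : 2 * Real.exp (2 * C) * (r / (1 - r)) ≤ η) (hη1 : η ≤ 1)
    (hx₀1 : x₀ ≤ 1) (hx₀ε : 8 * x₀ ^ ε ≤ 1) (hηx : (1 - x₀) ^ (ε / 2) ≤ 1 - η)
    (hB : Bound (P.erase p) t ε C T) (I J : Finset ℕ) (x y : ℕ → ℝ) (K : ℝ)
    (hI : Separated P I) (hJ : Separated P J) (hx : ∀ v ∈ I, 0 < x v) (hy : ∀ w ∈ J, 0 < y w)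
    (hbig : T * Real.exp (-(C * K * (1 + ε))) * (mass P x I * mass P y J) ^ ((1 + ε) / 2) <
      pairMass P x y (edges P t K x y I J)) :
    ∃ k : ℕ, pairMass P x y ((edges P t K x y I J).filter
        fun z => z.1.factorization p ≠ k ∧ z.2.factorization p ≠ k) ≤
      2 * ((8 * η) ^ (1 / (1 - q))) ^ (1 + ε) * pairMass P x y (edges P t K x y I J) := by
  set S := (I ∪ J).image (fun v => v.factorization p) with hS
  set a := mass P x I with ha
  set b := mass P y J with hb
  set Y := pairMass P x y (edges P t K x y I J) with hY
  set T' := T * Real.exp (-(C * K * (1 + ε))) with hT'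
  have hT'0 : 0 < T' := by positivity
  have ha0 : 0 ≤ a := mass_nonneg hP hx
  have hb0 : 0 ≤ b := mass_nonneg hP hy
  have hY0 : 0 < Y := lt_of_le_of_lt (by positivity) hbig
  have hapos : 0 < a ∧ 0 < b := by
    have hne : (edges P t K x y I J).Nonempty := by
      rw [Finset.nonempty_iff_ne_empty]; intro h
      rw [hY, h] at hY0; simp [pairMass] at hY0
    obtain ⟨z, hz⟩ := hne
    obtain ⟨h1, h2⟩ := Finset.mem_product.1 (Finset.mem_filter.1 hz).1
    exact ⟨Finset.sum_pos (fun v hv => wt_pos hP (hx v hv)) ⟨_, h1⟩,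
      Finset.sum_pos (fun v hv => wt_pos hP (hy v hv)) ⟨_, h2⟩⟩
  obtain ⟨hapos, hbpos⟩ := hapos
  set α : ℕ → ℝ := fun i => mass P x (I.filter fun v => v.factorization p = i) / a with hα
  set β : ℕ → ℝ := fun i => mass P y (J.filter fun v => v.factorization p = i) / b with hβ
  have hr0 : 0 ≤ r := by rw [hr]; positivity
  have hα0 : ∀ i, 0 ≤ α i := fun i =>
    div_nonneg (mass_nonneg hP fun v hv => hx v (Finset.mem_filter.1 hv).1) ha0
  have hβ0 : ∀ i, 0 ≤ β i := fun i =>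
    div_nonneg (mass_nonneg hP fun v hv => hy v (Finset.mem_filter.1 hv).1) hb0
  have hαs : ∑ i ∈ S, α i = 1 := by
    rw [hα, ← Finset.sum_div, sum_mass_fiber P x I (fun v => v.factorization p) S fun v hv =>
      Finset.mem_image_of_mem (fun v => v.factorization p) (Finset.mem_union_left _ hv)]
    exact div_self hapos.ne'
  have hβs : ∑ i ∈ S, β i = 1 := by
    rw [hβ, ← Finset.sum_div, sum_mass_fiber P y J (fun v => v.factorization p) S fun v hv =>
      Finset.mem_image_of_mem (fun v => v.factorization p) (Finset.mem_union_right _ hv)]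
    exact div_self hbpos.ne'
  have hfib : ∀ i j, pairMass P x y ((edges P t K x y I J).filter
      fun z => z.1.factorization p = i ∧ z.2.factorization p = j) ≤
      T' * (a * b) ^ q * (kernel (Real.exp (2 * C)) r i j * (α i * β j) ^ q) := by
    intro i j
    refine (pairMass_fiber_le hP hp hε hε' hC hT.le hq hr hB I J x y K hI hJ hx hy i j).trans
      (le_of_eq ?_)
    have e : mass P x (I.filter fun v => v.factorization p = i) *
        mass P y (J.filter fun v => v.factorization p = j) = (a * b) * (α i * β j) := by
      simp only [hα, hβ]; field_simp
    rw [e, Real.mul_rpow (by positivity) (mul_nonneg (hα0 i) (hβ0 j))]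
    ring
  have hsum : ∀ (A B : Finset ℕ) (E : Finset (ℕ × ℕ)), E ⊆ edges P t K x y I J →
      (∀ z ∈ E, z.1.factorization p ∈ A ∧ z.2.factorization p ∈ B) →
      pairMass P x y E ≤ T' * (a * b) ^ q *
        ∑ i ∈ A, ∑ j ∈ B, kernel (Real.exp (2 * C)) r i j * (α i * β j) ^ q := by
    intro A B E hE hAB
    rw [sum_pairMass_fiber P x y E (fun v => v.factorization p) A B hAB]
    simp_rw [Finset.mul_sum]
    refine Finset.sum_le_sum fun i _ => Finset.sum_le_sum fun j _ => ?_
    refine le_trans (pairMass_mono (Finset.filter_subset_filter _ hE) fun z hz => ?_) (hfib i j)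
    obtain ⟨h1, h2⟩ := Finset.mem_product.1
      (Finset.mem_filter.1 (Finset.mem_filter.1 hz).1).1
    exact (mul_pos (wt_pos hP (hx _ h1)) (wt_pos hP (hy _ h2))).le
  rw [← hq] at hbig
  have hT'q : 0 < T' * (a * b) ^ q := by positivity
  have hbig' : 1 < ∑ i ∈ S, ∑ j ∈ S, kernel (Real.exp (2 * C)) r i j * (α i * β j) ^ q := by
    have h := hsum S S _ (Finset.Subset.refl _) fun z hz => edges_factorization_mem p hz
    have h2 := lt_of_lt_of_le hbig h
    exact (lt_mul_iff_one_lt_right hT'q).1 h2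
  obtain ⟨k, hk, hbad⟩ := concentration hε hε' hq (Real.exp_pos (2 * C)).le hr0 hr1 hη hη1 hx₀1
    hx₀ε hηx S α β (fun i _ => hα0 i) (fun i _ => hβ0 i) hαs hβs hbig'
  refine ⟨k, ?_⟩
  have h := hsum (S.erase k) (S.erase k) _ (Finset.filter_subset
    (fun z => z.1.factorization p ≠ k ∧ z.2.factorization p ≠ k) (edges P t K x y I J)) (by
      intro z hz
      obtain ⟨h1, h2, h3⟩ := Finset.mem_filter.1 hz
      obtain ⟨h4, h5⟩ := edges_factorization_mem p h1
      exact ⟨Finset.mem_erase.2 ⟨h2, h4⟩, Finset.mem_erase.2 ⟨h3, h5⟩⟩)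
  refine h.trans ?_
  have hη0 : 0 ≤ η := le_trans (mul_nonneg (by positivity) (div_nonneg hr0 (by linarith))) hη
  calc _ ≤ T' * (a * b) ^ q * (2 * ((8 * η) ^ (1 / (1 - q))) ^ (1 + ε)) := by gcongr
    _ = 2 * ((8 * η) ^ (1 / (1 - q))) ^ (1 + ε) * (T' * (a * b) ^ q) := by ring
    _ ≤ _ := by gcongr

/-! ### Neighbourhoods in the concentrated case -/

/-- The numerator of `v / ∏ p ^ k p`, restricted to the primes in `P`. -/
def up (P : Finset ℕ) (k : ℕ → ℕ) (v : ℕ) : ℕ := ∏ p ∈ P, p ^ (v.factorization p - k p)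

/-- The denominator of `v / ∏ p ^ k p`, restricted to the primes in `P`. -/
noncomputable def down (P : Finset ℕ) (k : ℕ → ℕ) (v : ℕ) : ℝ :=
  ∏ p ∈ P, (p : ℝ) ^ (k p - v.factorization p)

/-- The number of primes `p ≤ t` in `P` at which the valuation of `v` differs from `k p`. -/
noncomputable def omegaAt (P : Finset ℕ) (k : ℕ → ℕ) (t : ℝ) (v : ℕ) : ℕ :=
  (P.filter fun p : ℕ => (p : ℝ) ≤ t ∧ v.factorization p ≠ k p).card

/-- The Euler product `∏ (1 + c / p)` over the primes `p ≤ t` in `P`. -/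
noncomputable def eulerProd (P : Finset ℕ) (t c : ℝ) : ℝ :=
  ∏ p ∈ P.filter (fun p : ℕ => (p : ℝ) ≤ t), (1 + c / (p : ℝ))

lemma eulerProd_zero (P : Finset ℕ) (t : ℝ) : eulerProd P t 0 = 1 := by simp [eulerProd]

lemma up_pos {P : Finset ℕ} (hP : ∀ p ∈ P, p.Prime) (k : ℕ → ℕ) (v : ℕ) : 0 < up P k v :=
  Finset.prod_pos fun p hp => pow_pos (hP p hp).pos _

lemma down_pos {P : Finset ℕ} (hP : ∀ p ∈ P, p.Prime) (k : ℕ → ℕ) (v : ℕ) : 0 < down P k v :=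
  Finset.prod_pos fun p hp => pow_pos (by exact_mod_cast (hP p hp).pos) _

lemma factorization_prod_pow_of_mem {P : Finset ℕ} (hP : ∀ p ∈ P, p.Prime) (e : ℕ → ℕ) {r : ℕ}
    (hr : r ∈ P) : (∏ p ∈ P, p ^ e p).factorization r = e r := by
  rw [Nat.factorization_prod_apply fun p hp => pow_ne_zero _ (hP p hp).ne_zero,
    Finset.sum_eq_single_of_mem r hr]
  · simp [(hP r hr).factorization_self]
  · intro p hp hpr
    simp [(hP p hp).factorization, hpr]

lemma excess_eq_up_mul_down {P : Finset ℕ} {k : ℕ → ℕ} {v w : ℕ}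
    (h : ∀ p ∈ P, v.factorization p = k p ∨ w.factorization p = k p) :
    excess P v w = up P k v * down P k w := by
  unfold excess up down
  push_cast
  rw [← Finset.prod_mul_distrib]
  refine Finset.prod_congr rfl fun p hp => ?_
  rw [← pow_add]
  congr 1
  rcases h p hp with h | h <;> omega

lemma omegaOn_le_add (P : Finset ℕ) (k : ℕ → ℕ) (t : ℝ) (v w : ℕ) :
    omegaOn P t v w ≤ omegaAt P k t v + omegaAt P k t w := by
  unfold omegaOn omegaAt
  refine (Finset.card_le_card ?_).trans (Finset.card_union_le _ _)
  intro p hp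
  simp only [Finset.mem_union, Finset.mem_filter] at hp ⊢
  by_cases h : v.factorization p = k p
  · exact Or.inr ⟨hp.1, hp.2.1, fun h' => hp.2.2 (h.trans h'.symm)⟩
  · exact Or.inl ⟨hp.1, hp.2.1, h⟩

/-- The identity `∑_{d ∣ n} φ(d) = n` for `n = p ^ k`, divided by `n`. -/
lemma sum_density_div_pow (p : ℕ) (k : ℕ) :
    ∑ s ∈ Finset.range (k + 1), density p (k - s) / (p : ℝ) ^ s = 1 := by
  induction k with
  | zero => simp [density]
  | succ k ih =>
    rw [Finset.sum_range_succ']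
    have : ∑ s ∈ Finset.range (k + 1), density p (k + 1 - (s + 1)) / (p : ℝ) ^ (s + 1) =
        1 / p := by
      rw [← ih, Finset.sum_div]
      refine Finset.sum_congr rfl fun s _ => ?_
      rw [Nat.add_sub_add_right, pow_succ]
      field_simp
    rw [this]
    simp [density]

lemma density_anti (p : ℕ) {i j : ℕ} (h : i ≤ j) : density p j ≤ density p i := by
  unfold density
  have : 0 ≤ 1 / (p : ℝ) := by positivity
  split_ifs <;> first | omega | linarith

/-- The local factor at `p` of the sum over denominators. -/
lemma sum_local_factor_le (p k : ℕ) (c : ℝ) (hc : 0 ≤ c) :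
    ∑ s ∈ Finset.range (k + 1), density p (k - s) / (p : ℝ) ^ s * (if s = 0 then 1 else 1 + c) ≤
      1 + c / p := by
  have h := sum_density_div_pow p k
  rw [Finset.sum_range_succ'] at h ⊢
  simp only [Nat.add_eq_zero_iff, one_ne_zero, and_false, if_false, if_true, pow_zero, div_one,
    mul_one, Nat.sub_zero] at h ⊢
  rw [← Finset.sum_mul]
  have h1 : 1 - density p k ≤ 1 / p := by
    unfold density
    have : 0 ≤ 1 / (p : ℝ) := by positivity
    split_ifs <;> linarith
  have h2 : c * (1 - density p k) ≤ c * (1 / p) := mul_le_mul_of_nonneg_left h1 hc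
  have e : c / (p : ℝ) = c * (1 / p) := by ring
  rw [e]
  nlinarith

/-- The weighted count of all integers `w`, written as `w = N * u / d` in lowest terms with
`N = ∏ p ^ k p`. It factors as a mean value over `u ≤ U` times a sum over `d ∣ N`, and the latter is
an Euler product whose value for `c = 0` is `∑_{d ∣ N} φ(N / d) / N = 1`. -/
lemma sum_density_div_down_le {P : Finset ℕ} (hP : ∀ p ∈ P, p.Prime) (k : ℕ → ℕ) (t c : ℝ)
    (hc : 0 ≤ c) (J : Finset ℕ) (hJ : Separated P J) (U : ℕ) (hU : ∀ w ∈ J, up P k w ≤ U) :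
    ∑ w ∈ J, (∏ p ∈ P, density p (w.factorization p)) / down P k w * (1 + c) ^ omegaAt P k t w ≤
      U * eulerProd P t c ^ 2 := by
  classical
  unfold eulerProd
  set Q := P.filter (fun p : ℕ => (p : ℝ) ≤ t) with hQ
  set g : ℕ → ℕ → ℝ := fun p s => density p (k p - s) / (p : ℝ) ^ s *
    (if s = 0 then 1 else 1 + (if (p : ℝ) ≤ t then c else 0)) with hg
  have hg0 : ∀ p ∈ P, ∀ s, 0 ≤ g p s := by
    intro p hp s
    have := density_pos (hP p hp) (k p - s)
    simp only [hg]
    split_ifs <;> positivity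
  set A : ℕ → ℝ := fun u => ∏ p ∈ Q, (if p ∣ u then 1 + c else 1) with hA
  have hA0 : ∀ u, 0 ≤ A u := fun u => Finset.prod_nonneg fun p _ => by split_ifs <;> linarith
  set G : ((p : ℕ) → p ∈ P → ℕ) → ℝ := fun s => ∏ p ∈ P.attach, g p.1 (s p.1 p.2) with hG
  have hG0 : ∀ s, 0 ≤ G s := fun s => Finset.prod_nonneg fun p _ => hg0 _ p.2 _
  set F : ℕ × ((p : ℕ) → p ∈ P → ℕ) → ℝ := fun z => A z.1 * G z.2 with hF
  set f : ℕ → ℕ × ((p : ℕ) → p ∈ P → ℕ) :=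
    fun w => (up P k w, fun p _ => k p - w.factorization p) with hf
  have hterm : ∀ w ∈ J, (∏ p ∈ P, density p (w.factorization p)) / down P k w *
      (1 + c) ^ omegaAt P k t w ≤ F (f w) := by
    intro w _
    have e1 : G (f w).2 = ∏ p ∈ P, g p (k p - w.factorization p) := by
      simp only [hG, hf]
      exact Finset.prod_attach P (fun p => g p (k p - w.factorization p))
    have e2 : (1 + c) ^ omegaAt P k t w =
        ∏ p ∈ P, (if (p : ℝ) ≤ t ∧ w.factorization p ≠ k p then 1 + c else 1) := by
      unfold omegaAt
      rw [← Finset.prod_const, Finset.prod_filter]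
    have e3 : A (f w).1 = ∏ p ∈ P, (if (p : ℝ) ≤ t then
        (if p ∣ up P k w then 1 + c else 1) else 1) := by
      simp only [hA, hf, hQ]
      rw [Finset.prod_filter]
    simp only [hF]
    rw [e1, e2, e3, down, ← Finset.prod_div_distrib, ← Finset.prod_mul_distrib,
      ← Finset.prod_mul_distrib]
    refine Finset.prod_le_prod (fun p hp => ?_) fun p hp => ?_
    · have := density_pos (hP p hp) (w.factorization p)
      split_ifs <;> positivity
    · have hd := density_pos (hP p hp) (w.factorization p)
      have hp0 : (0 : ℝ) < p := by exact_mod_cast (hP p hp).pos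
      by_cases hlt : w.factorization p < k p
      · have hs : k p - w.factorization p ≠ 0 := by omega
        have hs' : k p - (k p - w.factorization p) = w.factorization p := by omega
        simp only [hg, if_neg hs, hs']
        have hne : w.factorization p ≠ k p := hlt.ne
        have hX : 0 ≤ density p (w.factorization p) / (p : ℝ) ^ (k p - w.factorization p) := by
          positivity
        by_cases ht : (p : ℝ) ≤ t
        · simp only [ht, hne, if_true, ne_eq, not_false_eq_true, and_self]
          have h2 : (1 : ℝ) ≤ if p ∣ up P k w then 1 + c else 1 := by split_ifs <;> linarith
          exact le_mul_of_one_le_left (by positivity) h2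
        · simp [ht]
      · have hs : k p - w.factorization p = 0 := by omega
        have hle : density p (w.factorization p) ≤ density p (k p) := density_anti p (by omega)
        simp only [hg, hs, pow_zero, div_one, if_true, mul_one, Nat.sub_zero]
        by_cases ht : (p : ℝ) ≤ t
        · by_cases he : w.factorization p = k p
          · simp only [he, ne_eq, not_true_eq_false, and_false, if_false, mul_one, ht, if_true]
            have h2 : (1 : ℝ) ≤ if p ∣ up P k w then 1 + c else 1 := by split_ifs <;> linarith
            exact le_mul_of_one_le_left (density_pos (hP p hp) _).le h2
          · have hdvd : p ∣ up P k w := by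
              refine dvd_trans (dvd_pow_self p ?_) (Finset.dvd_prod_of_mem _ hp)
              omega
            simp only [ht, he, ne_eq, not_false_eq_true, and_self, if_true, hdvd]
            rw [mul_comm]
            gcongr
        · simpa [ht] using hle
  have hinj : Set.InjOn f J := by
    intro v hv w hw h
    refine hJ v hv w hw fun p hp => ?_
    simp only [hf, Prod.mk.injEq] at h
    have h1 : (up P k v).factorization p = (up P k w).factorization p := by rw [h.1]
    unfold up at h1
    rw [factorization_prod_pow_of_mem hP (fun p => v.factorization p - k p) hp,
      factorization_prod_pow_of_mem hP (fun p => w.factorization p - k p) hp] at h1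
    have h2 := congrFun (congrFun h.2 p) hp
    omega
  have hmaps : J.image f ⊆ Finset.Icc 1 U ×ˢ P.pi (fun p => Finset.range (k p + 1)) := by
    intro z hz
    obtain ⟨w, hw, rfl⟩ := Finset.mem_image.1 hz
    refine Finset.mem_product.2 ⟨Finset.mem_Icc.2 ⟨up_pos hP k w, hU w hw⟩, ?_⟩
    refine Finset.mem_pi.2 fun p hp => Finset.mem_range.2 ?_
    simp only [hf]
    omega
  have hsumA : ∑ u ∈ Finset.Icc 1 U, A u ≤ U * ∏ p ∈ Q, (1 + c / (p : ℝ)) :=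
    sum_prod_ite_dvd_le Q (fun p hp => hP p (Finset.mem_filter.1 hp).1) c hc U
  have hsumG : ∑ s ∈ P.pi (fun p => Finset.range (k p + 1)), G s ≤
      ∏ p ∈ Q, (1 + c / (p : ℝ)) := by
    simp only [hG]
    rw [← Finset.prod_sum, hQ, Finset.prod_filter]
    refine Finset.prod_le_prod (fun p hp => Finset.sum_nonneg fun s _ => hg0 p hp s)
      fun p hp => ?_
    have h := sum_local_factor_le p (k p) (if (p : ℝ) ≤ t then c else 0) (by split_ifs <;> simp [hc])
    refine h.trans ?_
    split_ifs <;> simp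
  calc _ ≤ ∑ w ∈ J, F (f w) := Finset.sum_le_sum hterm
    _ = ∑ z ∈ J.image f, F z := (Finset.sum_image hinj).symm
    _ ≤ ∑ z ∈ Finset.Icc 1 U ×ˢ P.pi (fun p => Finset.range (k p + 1)), F z :=
        Finset.sum_le_sum_of_subset_of_nonneg hmaps fun z _ _ => mul_nonneg (hA0 _) (hG0 _)
    _ = (∑ u ∈ Finset.Icc 1 U, A u) * ∑ s ∈ P.pi (fun p => Finset.range (k p + 1)), G s := by
        rw [Finset.sum_mul_sum, ← Finset.sum_product']
    _ ≤ (U * ∏ p ∈ Q, (1 + c / (p : ℝ))) * ∏ p ∈ Q, (1 + c / (p : ℝ)) :=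
        mul_le_mul hsumA hsumG (Finset.sum_nonneg fun s _ => hG0 s)
          (mul_nonneg (Nat.cast_nonneg U) (Finset.prod_nonneg fun p _ => by positivity))
    _ = _ := by ring

/-- Rankin's trick: the condition `κ ≤ omegaAt P k t w` is paid for by the factor
`exp (B * (omegaAt P k t w - κ)) ≥ 1`. -/
lemma mass_neighbours_le {P : Finset ℕ} (hP : ∀ p ∈ P, p.Prime) (k : ℕ → ℕ) (t B κ : ℝ)
    (hB : 0 ≤ B) (J : Finset ℕ) (hJ : Separated P J) (y : ℕ → ℝ) (U : ℕ) (V : ℝ) (hV : 0 < V)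
    (hU : ∀ w ∈ J, up P k w ≤ U) (hy : ∀ w ∈ J, y w * (V * down P k w) ≤ 1)
    (hκ : ∀ w ∈ J, κ ≤ omegaAt P k t w) :
    mass P y J ≤ U / V * (eulerProd P t (Real.exp B - 1) ^ 2 * Real.exp (-(B * κ))) := by
  have h := sum_density_div_down_le hP k t (Real.exp B - 1)
    (by linarith [Real.one_le_exp hB]) J hJ U hU
  calc mass P y J ≤ ∑ w ∈ J, Real.exp (-(B * κ)) / V *
      ((∏ p ∈ P, density p (w.factorization p)) / down P k w *
        (1 + (Real.exp B - 1)) ^ omegaAt P k t w) := by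
        refine Finset.sum_le_sum fun w hw => ?_
        have hd := down_pos hP k w
        have hD : 0 < ∏ p ∈ P, density p (w.factorization p) :=
          Finset.prod_pos fun p hp => density_pos (hP p hp) _
        have h1 : y w ≤ 1 / (V * down P k w) := by
          rw [le_div_iff₀ (by positivity)]; exact hy w hw
        have h2 : 1 ≤ Real.exp (-(B * κ)) * (1 + (Real.exp B - 1)) ^ omegaAt P k t w := by
          rw [add_sub_cancel, ← Real.exp_nat_mul, ← Real.exp_add]
          refine Real.one_le_exp ?_
          nlinarith [hκ w hw]
        unfold wt
        calc _ ≤ (∏ p ∈ P, density p (w.factorization p)) * (1 / (V * down P k w)) := by gcongr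
          _ ≤ (∏ p ∈ P, density p (w.factorization p)) * (1 / (V * down P k w)) *
              (Real.exp (-(B * κ)) * (1 + (Real.exp B - 1)) ^ omegaAt P k t w) :=
              le_mul_of_one_le_right (by positivity) h2
          _ = _ := by field_simp
    _ = Real.exp (-(B * κ)) / V * ∑ w ∈ J, ((∏ p ∈ P, density p (w.factorization p)) / down P k w *
        (1 + (Real.exp B - 1)) ^ omegaAt P k t w) := by rw [Finset.mul_sum]
    _ ≤ Real.exp (-(B * κ)) / V * _ := mul_le_mul_of_nonneg_left h (by positivity)
    _ = _ := by ring

/-! ### Subgraphs of large minimum degree -/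

/-- A weighted bipartite graph has a nonempty induced subgraph in which every vertex has degree at
least a quarter of the average degree. The subgraph maximises the edge mass minus suitable multiples
of the vertex masses. -/
lemma exists_large_degrees (I J : Finset ℕ) (E : Finset (ℕ × ℕ)) (hE : E ⊆ I ×ˢ J) (a b : ℕ → ℝ)
    (ha : ∀ v ∈ I, 0 < a v) (hb : ∀ w ∈ J, 0 < b w) (hm : 0 < ∑ z ∈ E, a z.1 * b z.2) :
    ∃ I' ⊆ I, ∃ J' ⊆ J, I'.Nonempty ∧ J'.Nonempty ∧
      (∀ v ∈ I', ∑ z ∈ E, a z.1 * b z.2 ≤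
        4 * (∑ v ∈ I, a v) * ∑ w ∈ J'.filter (fun w => (v, w) ∈ E), b w) ∧
      (∀ w ∈ J', ∑ z ∈ E, a z.1 * b z.2 ≤
        4 * (∑ w ∈ J, b w) * ∑ v ∈ I'.filter (fun v => (v, w) ∈ E), a v) := by
  set m := ∑ z ∈ E, a z.1 * b z.2 with hmdef
  have hEne : E.Nonempty := by
    rw [Finset.nonempty_iff_ne_empty]; rintro rfl; simp [hmdef] at hm
  obtain ⟨z₀, hz₀⟩ := hEne
  obtain ⟨hz₁, hz₂⟩ := Finset.mem_product.1 (hE hz₀)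
  have hA : 0 < ∑ v ∈ I, a v := Finset.sum_pos ha ⟨_, hz₁⟩
  have hB : 0 < ∑ w ∈ J, b w := Finset.sum_pos hb ⟨_, hz₂⟩
  set A := ∑ v ∈ I, a v
  set B := ∑ w ∈ J, b w
  set F : Finset ℕ × Finset ℕ → ℝ := fun s =>
    (∑ v ∈ s.1, ∑ w ∈ s.2, if (v, w) ∈ E then a v * b w else 0)
      - m / (4 * A) * ∑ v ∈ s.1, a v - m / (4 * B) * ∑ w ∈ s.2, b w with hF
  obtain ⟨⟨I', J'⟩, hmem, hmax⟩ := Finset.exists_max_image (I.powerset ×ˢ J.powerset) F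
    ⟨(I, J), by simp⟩
  simp only [Finset.mem_product, Finset.mem_powerset, Prod.forall] at hmem hmax
  obtain ⟨hI', hJ'⟩ := hmem
  have hFull : F (I, J) = m / 2 := by
    have e : ∑ v ∈ I, ∑ w ∈ J, (if (v, w) ∈ E then a v * b w else 0) = m := by
      rw [← Finset.sum_product' (f := fun v w => if (v, w) ∈ E then a v * b w else 0)]
      rw [← Finset.sum_filter, Finset.filter_mem_eq_inter, Finset.inter_eq_right.2 hE]
    simp only [hF, e]
    field_simp
    ring
  have hpos : 0 < F (I', J') := by
    have := hmax I J ⟨Finset.Subset.refl _, Finset.Subset.refl _⟩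
    linarith
  have hb0 : ∀ J'' ⊆ J, 0 ≤ ∑ w ∈ J'', b w := fun J'' h =>
    Finset.sum_nonneg fun w hw => (hb w (h hw)).le
  have ha0 : ∀ I'' ⊆ I, 0 ≤ ∑ w ∈ I'', a w := fun J'' h =>
    Finset.sum_nonneg fun w hw => (ha w (h hw)).le
  refine ⟨I', hI', J', hJ', ?_, ?_, ?_, ?_⟩
  · rw [Finset.nonempty_iff_ne_empty]
    rintro rfl
    have h1 : 0 ≤ m / (4 * B) * ∑ w ∈ J', b w := mul_nonneg (by positivity) (hb0 J' hJ')
    simp only [hF, Finset.sum_empty] at hpos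
    linarith
  · rw [Finset.nonempty_iff_ne_empty]
    rintro rfl
    have h1 : 0 ≤ m / (4 * A) * ∑ w ∈ I', a w := mul_nonneg (by positivity) (ha0 I' hI')
    simp only [hF, Finset.sum_empty, Finset.sum_const_zero] at hpos
    linarith
  · intro v hv
    have h := hmax (I'.erase v) J' ⟨(Finset.erase_subset _ _).trans hI', hJ'⟩
    simp only [hF] at h
    rw [← Finset.add_sum_erase I' a hv, ← Finset.add_sum_erase I'
      (fun v => ∑ w ∈ J', if (v, w) ∈ E then a v * b w else 0) hv] at h
    have e : ∑ w ∈ J', (if (v, w) ∈ E then a v * b w else 0) =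
        a v * ∑ w ∈ J'.filter (fun w => (v, w) ∈ E), b w := by
      rw [Finset.sum_filter, Finset.mul_sum]
      exact Finset.sum_congr rfl fun w _ => by split_ifs <;> simp
    rw [e] at h
    have h2 : a v * (m / (4 * A)) ≤ a v * ∑ w ∈ J'.filter (fun w => (v, w) ∈ E), b w := by linarith
    have h3 := le_of_mul_le_mul_left h2 (ha v (hI' hv))
    rw [div_le_iff₀ (by positivity)] at h3
    linarith
  · intro w hw
    have h := hmax I' (J'.erase w) ⟨hI', (Finset.erase_subset _ _).trans hJ'⟩
    simp only [hF] at h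
    rw [Finset.sum_comm, Finset.sum_comm (s := I')] at h
    rw [← Finset.add_sum_erase J' b hw, ← Finset.add_sum_erase J'
      (fun w => ∑ v ∈ I', if (v, w) ∈ E then a v * b w else 0) hw] at h
    have e : ∑ v ∈ I', (if (v, w) ∈ E then a v * b w else 0) =
        b w * ∑ v ∈ I'.filter (fun v => (v, w) ∈ E), a v := by
      rw [Finset.sum_filter, Finset.mul_sum]
      exact Finset.sum_congr rfl fun w _ => by split_ifs <;> simp [mul_comm]
    rw [e] at h
    have h2 : b w * (m / (4 * B)) ≤ b w * ∑ v ∈ I'.filter (fun v => (v, w) ∈ E), a v := by linarith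
    have h3 := le_of_mul_le_mul_left h2 (hb w (hJ' hw))
    rw [div_le_iff₀ (by positivity)] at h3
    linarith

/-! ### The bound in the concentrated case -/

/-- If every pair in `E` has, at each prime, at least one component with the valuation prescribed by
`k`, compare the neighbourhoods of the two vertices `v₀` and `w₀` with the largest numerators: the
factors `up w₀ / up v₀` and `up v₀ / up w₀` cancel. -/
lemma sq_pairMass_le {P : Finset ℕ} (hP : ∀ p ∈ P, p.Prime) (k : ℕ → ℕ) (t B κ K : ℝ)
    (hB : 0 ≤ B) (I J : Finset ℕ) (x y : ℕ → ℝ) (hI : Separated P I) (hJ : Separated P J)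
    (hx : ∀ v ∈ I, 0 < x v) (hy : ∀ w ∈ J, 0 < y w) (E : Finset (ℕ × ℕ))
    (hE : E ⊆ edges P t K x y I J)
    (hgood : ∀ z ∈ E, ∀ p ∈ P, z.1.factorization p = k p ∨ z.2.factorization p = k p)
    (hside : (∀ z ∈ E, κ ≤ omegaAt P k t z.1) ∨ (∀ z ∈ E, κ ≤ omegaAt P k t z.2)) :
    pairMass P x y E ^ 2 ≤ 16 * (mass P x I * mass P y J) *
      (eulerProd P t (Real.exp B - 1) ^ 2 *
        Real.exp (-(B * κ))) := by
  have hEIJ : E ⊆ I ×ˢ J := hE.trans (Finset.filter_subset _ _)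
  have ha : ∀ v ∈ I, 0 < wt P x v := fun v hv => wt_pos hP (hx v hv)
  have hb : ∀ v ∈ J, 0 < wt P y v := fun v hv => wt_pos hP (hy v hv)
  have hA : 0 ≤ mass P x I := mass_nonneg hP hx
  have hB' : 0 ≤ mass P y J := mass_nonneg hP hy
  have hm0 : 0 ≤ pairMass P x y E := Finset.sum_nonneg fun z hz => by
    obtain ⟨h1, h2⟩ := Finset.mem_product.1 (hEIJ hz)
    exact (mul_pos (ha _ h1) (hb _ h2)).le
  rcases hm0.eq_or_lt with h0 | hm
  · rw [← h0, zero_pow two_ne_zero]; positivity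
  obtain ⟨I', hI', J', hJ', hI'ne, hJ'ne, hdegI, hdegJ⟩ :=
    exists_large_degrees I J E hEIJ (wt P x) (wt P y) ha hb hm
  obtain ⟨v₀, hv₀, hv₀max⟩ := Finset.exists_max_image I' (up P k) hI'ne
  obtain ⟨w₀, hw₀, hw₀max⟩ := Finset.exists_max_image J' (up P k) hJ'ne
  set Γ₁ := J'.filter (fun w => (v₀, w) ∈ E) with hΓ₁
  set Γ₂ := I'.filter (fun v => (v, w₀) ∈ E) with hΓ₂
  have h1 : pairMass P x y E ≤ 4 * mass P x I * mass P y Γ₁ := hdegI v₀ hv₀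
  have h2 : pairMass P x y E ≤ 4 * mass P y J * mass P x Γ₂ := hdegJ w₀ hw₀
  set V : ℝ := (up P k v₀ : ℝ) with hV
  set W : ℝ := (up P k w₀ : ℝ) with hW
  have hV0 : 0 < V := Nat.cast_pos.2 (up_pos hP k v₀)
  have hW0 : 0 < W := Nat.cast_pos.2 (up_pos hP k w₀)
  have hΓ₁sub : Γ₁ ⊆ J := (Finset.filter_subset _ _).trans hJ'
  have hΓ₂sub : Γ₂ ⊆ I := (Finset.filter_subset _ _).trans hI'
  have hmem₁ : ∀ w ∈ Γ₁, (v₀, w) ∈ E := fun w hw => (Finset.mem_filter.1 hw).2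
  have hmem₂ : ∀ v ∈ Γ₂, (v, w₀) ∈ E := fun v hv => (Finset.mem_filter.1 hv).2
  have hsep₁ : Separated P Γ₁ := fun v hv w hw => hJ v (hΓ₁sub hv) w (hΓ₁sub hw)
  have hsep₂ : Separated P Γ₂ := fun v hv w hw => hI v (hΓ₂sub hv) w (hΓ₂sub hw)
  have hy₁ : ∀ w ∈ Γ₁, y w * (V * down P k w) ≤ 1 := by
    intro w hw
    rw [hV, ← excess_eq_up_mul_down (hgood _ (hmem₁ w hw))]
    exact (Finset.mem_filter.1 (hE (hmem₁ w hw))).2.2.1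
  have hx₂ : ∀ v ∈ Γ₂, x v * (W * down P k v) ≤ 1 := by
    intro v hv
    rw [hW, ← excess_eq_up_mul_down fun p hp => (hgood _ (hmem₂ v hv) p hp).symm]
    exact (Finset.mem_filter.1 (hE (hmem₂ v hv))).2.1
  have d₁ : ∀ B' κ' : ℝ, 0 ≤ B' → (∀ w ∈ Γ₁, κ' ≤ omegaAt P k t w) → mass P y Γ₁ ≤
      W / V * (eulerProd P t (Real.exp B' - 1) ^ 2 * Real.exp (-(B' * κ'))) := fun B' κ' hB' hκ' =>
    mass_neighbours_le hP k t B' κ' hB' Γ₁ hsep₁ y (up P k w₀) V hV0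
      (fun w hw => hw₀max w (Finset.mem_filter.1 hw).1) hy₁ hκ'
  have d₂ : ∀ B' κ' : ℝ, 0 ≤ B' → (∀ w ∈ Γ₂, κ' ≤ omegaAt P k t w) → mass P x Γ₂ ≤
      V / W * (eulerProd P t (Real.exp B' - 1) ^ 2 * Real.exp (-(B' * κ'))) := fun B' κ' hB' hκ' =>
    mass_neighbours_le hP k t B' κ' hB' Γ₂ hsep₂ x (up P k v₀) W hW0
      (fun w hw => hv₀max w (Finset.mem_filter.1 hw).1) hx₂ hκ'
  set G := eulerProd P t (Real.exp B - 1) ^ 2 * Real.exp (-(B * κ)) with hG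
  have hG0 : 0 ≤ G := by positivity
  have hp₁ : 0 ≤ mass P y Γ₁ := mass_nonneg hP fun w hw => hy w (hΓ₁sub hw)
  have hp₂ : 0 ≤ mass P x Γ₂ := mass_nonneg hP fun w hw => hx w (hΓ₂sub hw)
  have hprod : mass P y Γ₁ * mass P x Γ₂ ≤ G := by
    have hVW : 0 ≤ W / V := by positivity
    rcases hside with hs | hs
    · have e₁ := d₁ 0 0 le_rfl fun w _ => by positivity
      have e₂ := d₂ B κ hB fun v hv => hs (v, w₀) (hmem₂ v hv)
      rw [← hG] at e₂
      simp only [Real.exp_zero, sub_self, eulerProd_zero, one_pow, mul_zero, neg_zero, mul_one] at e₁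
      calc _ ≤ W / V * (V / W * G) := mul_le_mul e₁ e₂ hp₂ hVW
        _ = G := by field_simp
    · have e₁ := d₁ B κ hB fun w hw => hs (v₀, w) (hmem₁ w hw)
      rw [← hG] at e₁
      have e₂ := d₂ 0 0 le_rfl fun w _ => by positivity
      simp only [Real.exp_zero, sub_self, eulerProd_zero, one_pow, mul_zero, neg_zero, mul_one] at e₂
      calc _ ≤ (W / V * G) * (V / W) := mul_le_mul e₁ e₂ hp₂ (mul_nonneg hVW hG0)
        _ = G := by field_simp
  calc pairMass P x y E ^ 2 = pairMass P x y E * pairMass P x y E := sq _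
    _ ≤ (4 * mass P x I * mass P y Γ₁) * (4 * mass P y J * mass P x Γ₂) :=
        mul_le_mul h1 h2 hm0 (by positivity)
    _ = 16 * (mass P x I * mass P y J) * (mass P y Γ₁ * mass P x Γ₂) := by ring
    _ ≤ _ := mul_le_mul_of_nonneg_left hprod (by positivity)

/-- The estimate for a system that is concentrated at the valuations `k p`: half of the weight lies
on pairs that meet `k` at every prime, and half of that on pairs in which a fixed one of the two
components accounts for at least half of the primes counted by `omegaOn`. -/
lemma sq_pairMass_edges_le {P : Finset ℕ} (hP : ∀ p ∈ P, p.Prime) (k : ℕ → ℕ) (t B K : ℝ)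
    (hB : 0 ≤ B) (I J : Finset ℕ) (x y : ℕ → ℝ) (hI : Separated P I) (hJ : Separated P J)
    (hx : ∀ v ∈ I, 0 < x v) (hy : ∀ w ∈ J, 0 < y w)
    (hbad : ∑ p ∈ P, pairMass P x y ((edges P t K x y I J).filter
      fun z => z.1.factorization p ≠ k p ∧ z.2.factorization p ≠ k p) ≤
        1 / 2 * pairMass P x y (edges P t K x y I J)) :
    pairMass P x y (edges P t K x y I J) ^ 2 ≤ 256 * (mass P x I * mass P y J) *
      (eulerProd P t (Real.exp B - 1) ^ 2 *
        Real.exp (-(B * (K / 2)))) := by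
  classical
  set E := edges P t K x y I J with hEdef
  have hpos : ∀ z ∈ E, 0 ≤ wt P x z.1 * wt P y z.2 := fun z hz => by
    obtain ⟨h1, h2⟩ := Finset.mem_product.1 (Finset.mem_filter.1 hz).1
    exact (mul_pos (wt_pos hP (hx _ h1)) (wt_pos hP (hy _ h2))).le
  have hpm0 : ∀ F ⊆ E, 0 ≤ pairMass P x y F := fun F hF =>
    Finset.sum_nonneg fun z hz => hpos z (hF hz)
  set good : ℕ × ℕ → Prop := fun z => ∀ p ∈ P, z.1.factorization p = k p ∨ z.2.factorization p = k p
    with hgood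
  set E₀ := E.filter fun z => good z with hE₀
  set E₁ := E₀.filter fun z => K / 2 ≤ (omegaAt P k t z.1 : ℝ) with hE₁
  set E₂ := E₀.filter fun z => ¬ K / 2 ≤ (omegaAt P k t z.1 : ℝ) with hE₂
  have hE₀E : E₀ ⊆ E := Finset.filter_subset _ _
  have hE₁E₀ : E₁ ⊆ E₀ := Finset.filter_subset _ _
  have hE₂E₀ : E₂ ⊆ E₀ := Finset.filter_subset _ _
  have hsplit : pairMass P x y E₁ + pairMass P x y E₂ = pairMass P x y E₀ :=
    Finset.sum_filter_add_sum_filter_not _ _ _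
  have hsplit' : pairMass P x y E₀ + pairMass P x y (E.filter fun z => ¬ good z) =
      pairMass P x y E := Finset.sum_filter_add_sum_filter_not _ _ _
  have hnot : pairMass P x y (E.filter fun z => ¬ good z) ≤ 1 / 2 * pairMass P x y E := by
    refine le_trans ?_ hbad
    unfold pairMass
    simp_rw [Finset.sum_filter]
    rw [Finset.sum_comm]
    refine Finset.sum_le_sum fun z hz => ?_
    have hnn : ∀ p ∈ P, 0 ≤ (if z.1.factorization p ≠ k p ∧ z.2.factorization p ≠ k p then
        wt P x z.1 * wt P y z.2 else 0) := fun p _ => by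
      split_ifs
      · exact hpos z hz
      · exact le_rfl
    by_cases hg : good z
    · rw [if_neg (not_not.2 hg)]
      exact Finset.sum_nonneg hnn
    · rw [if_pos hg]
      simp only [hgood] at hg
      push Not at hg
      obtain ⟨p, hp, h⟩ := hg
      refine le_trans ?_ (Finset.single_le_sum hnn hp)
      rw [if_pos h]
  have main : ∀ F ⊆ E₀, ((∀ z ∈ F, K / 2 ≤ (omegaAt P k t z.1 : ℝ)) ∨
      (∀ z ∈ F, K / 2 ≤ (omegaAt P k t z.2 : ℝ))) → 1 / 4 * pairMass P x y E ≤ pairMass P x y F →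
      pairMass P x y E ^ 2 ≤ 256 * (mass P x I * mass P y J) *
        (eulerProd P t (Real.exp B - 1) ^ 2 * Real.exp (-(B * (K / 2)))) := fun F hF hs hle => by
    have h := sq_pairMass_le hP k t B (K / 2) K hB I J x y hI hJ hx hy F (hF.trans hE₀E)
      (fun z hz => (Finset.mem_filter.1 (hF hz)).2) hs
    have h0 := hpm0 E (Finset.Subset.refl _)
    have h1 : (1 / 4 * pairMass P x y E) ^ 2 ≤ pairMass P x y F ^ 2 :=
      pow_le_pow_left₀ (by positivity) hle 2
    have h2 : pairMass P x y E ^ 2 ≤ 16 * (16 * (mass P x I * mass P y J) *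
      (eulerProd P t (Real.exp B - 1) ^ 2 *
        Real.exp (-(B * (K / 2))))) := by
      refine le_trans (le_of_eq ?_) (mul_le_mul_of_nonneg_left (h1.trans h) (by norm_num))
      ring
    exact h2.trans (le_of_eq (by ring))
  rcases le_total (1 / 4 * pairMass P x y E) (pairMass P x y E₁) with h | h
  · exact main E₁ hE₁E₀ (Or.inl fun z hz => (Finset.mem_filter.1 hz).2) h
  · refine main E₂ hE₂E₀ (Or.inr fun z hz => ?_) (by linarith)
    obtain ⟨h1, h2⟩ := Finset.mem_filter.1 hz
    have h3 : K ≤ (omegaOn P t z.1 z.2 : ℝ) := (Finset.mem_filter.1 (hE₀E h1)).2.2.2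
    have h4 : (omegaOn P t z.1 z.2 : ℝ) ≤ omegaAt P k t z.1 + omegaAt P k t z.2 := by
      exact_mod_cast omegaOn_le_add P k t z.1 z.2
    push Not at h2
    linarith

/-- Interpolation between the trivial bound `Y ≤ X` and `Y ≤ R * X ^ (1 / 2)`. -/
lemma le_of_interpolation {X Y R ε : ℝ} (hε : 0 ≤ ε) (hε1 : ε ≤ 1) (hX : 0 ≤ X) (hY : 0 ≤ Y)
    (hR : 0 ≤ R) (h1 : Y ≤ X) (h2 : Y ^ 2 ≤ R ^ 2 * X) :
    Y ≤ R ^ (1 - ε) * X ^ ((1 + ε) / 2) := by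
  have h3 : Y ≤ R * X ^ (1 / 2 : ℝ) := by
    refine (abs_le_of_sq_le_sq' ?_ (by positivity)).2
    rw [mul_pow, ← Real.rpow_natCast (X ^ (1 / 2 : ℝ)) 2, ← Real.rpow_mul hX]
    norm_num
    exact h2
  have h4 : Y = Y ^ ε * Y ^ (1 - ε) := by
    rw [← Real.rpow_add_of_nonneg hY hε (by linarith)]; simp
  rw [h4]
  calc _ ≤ X ^ ε * (R * X ^ (1 / 2 : ℝ)) ^ (1 - ε) :=
        mul_le_mul (Real.rpow_le_rpow hY h1 hε) (Real.rpow_le_rpow hY h3 (by linarith))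
          (by positivity) (by positivity)
    _ = R ^ (1 - ε) * (X ^ ε * X ^ ((1 / 2) * (1 - ε))) := by
        rw [Real.mul_rpow hR (by positivity), ← Real.rpow_mul hX]; ring
    _ = _ := by
        rw [← Real.rpow_add_of_nonneg hX hε (by linarith)]
        congr 2; ring

/-! ### Induction over the primes -/

lemma pairMass_edges_le {P : Finset ℕ} (hP : ∀ p ∈ P, p.Prime) {t K : ℝ} {x y : ℕ → ℝ}
    {I J : Finset ℕ} (hx : ∀ v ∈ I, 0 < x v) (hy : ∀ w ∈ J, 0 < y w) :
    pairMass P x y (edges P t K x y I J) ≤ mass P x I * mass P y J := by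
  refine (pairMass_mono (Finset.filter_subset _ _) fun z hz => ?_).trans (le_of_eq ?_)
  · obtain ⟨h1, h2⟩ := Finset.mem_product.1 hz
    exact (mul_pos (wt_pos hP (hx _ h1)) (wt_pos hP (hy _ h2))).le
  · unfold pairMass mass
    rw [Finset.sum_mul_sum, ← Finset.sum_product']

/-- The exponential parameter `B = 4 C (1 + ε) / (1 - ε)`, at most `36 C`, is chosen so that the
factor `exp (- B K / 4)` of the concentrated case becomes `exp (- C K (1 + ε))` after
interpolation. -/
lemma bound_of_concentrated {ε C t κ K : ℝ} (hε : 0 < ε) (hε' : ε ≤ 4 / 5) (hC : 0 < C)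
    (hκ : 1 ≤ κ) {P : Finset ℕ} (hP : ∀ p ∈ P, p.Prime)
    (hprod : eulerProd P t (Real.exp (4 * C * (1 + ε) / (1 - ε)) - 1) ≤
      κ * Log t ^ (Real.exp (4 * C * (1 + ε) / (1 - ε)) - 1))
    (I J : Finset ℕ) (x y : ℕ → ℝ) (hI : Separated P I) (hJ : Separated P J)
    (hx : ∀ v ∈ I, 0 < x v) (hy : ∀ w ∈ J, 0 < y w) (k : ℕ → ℕ)
    (hbad : ∑ p ∈ P, pairMass P x y ((edges P t K x y I J).filter
      fun z => z.1.factorization p ≠ k p ∧ z.2.factorization p ≠ k p) ≤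
        1 / 2 * pairMass P x y (edges P t K x y I J)) :
    pairMass P x y (edges P t K x y I J) ≤
      16 * κ * Log t ^ ((1 / 2 : ℝ) * (Real.exp (80 * C) - 1)) *
        Real.exp (-(C * K * (1 + ε))) * (mass P x I * mass P y J) ^ ((1 + ε) / 2) := by
  set B : ℝ := 4 * C * (1 + ε) / (1 - ε) with hBdef
  have h1ε : 0 < 1 - ε := by linarith
  have hB0 : 0 ≤ B := by positivity
  have hB40 : B ≤ 40 * C := by
    rw [hBdef, div_le_iff₀ h1ε]; nlinarith
  set c : ℝ := Real.exp B - 1 with hc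
  have hc0 : 0 ≤ c := by linarith [Real.one_le_exp hB0]
  have hL := Log_pos t
  have hL1 := one_le_Log t
  set X := mass P x I * mass P y J with hX
  have hX0 : 0 ≤ X := mul_nonneg (mass_nonneg hP hx) (mass_nonneg hP hy)
  set Y := pairMass P x y (edges P t K x y I J) with hY
  have hY0 : 0 ≤ Y := Finset.sum_nonneg fun z hz => by
    obtain ⟨h1, h2⟩ := Finset.mem_product.1 (Finset.mem_filter.1 hz).1
    exact (mul_pos (wt_pos hP (hx _ h1)) (wt_pos hP (hy _ h2))).le
  have he0 : 0 ≤ eulerProd P t c := Finset.prod_nonneg fun p _ => by positivity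
  set R : ℝ := 16 * κ * Log t ^ c * Real.exp (-(B * K / 4)) with hR
  have hR0 : 0 ≤ R := by positivity
  have hsq : Y ^ 2 ≤ R ^ 2 * X := by
    have h := sq_pairMass_edges_le hP k t B K hB0 I J x y hI hJ hx hy hbad
    refine h.trans ?_
    have e : Real.exp (-(B * (K / 2))) = Real.exp (-(B * K / 4)) ^ 2 := by
      rw [← Real.exp_nat_mul]; congr 1; push_cast; ring
    rw [e]
    calc 256 * X * (eulerProd P t c ^ 2 * Real.exp (-(B * K / 4)) ^ 2)
        ≤ 256 * X * ((κ * Log t ^ c) ^ 2 * Real.exp (-(B * K / 4)) ^ 2) := by gcongr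
      _ = R ^ 2 * X := by rw [hR]; ring
  have h := le_of_interpolation hε.le (by linarith) hX0 hY0 hR0 (pairMass_edges_le hP hx hy) hsq
  refine h.trans (mul_le_mul_of_nonneg_right ?_ (by positivity))
  have hRe : R ^ (1 - ε) = (16 * κ) ^ (1 - ε) * Log t ^ (c * (1 - ε)) *
      Real.exp (-(C * K * (1 + ε))) := by
    rw [hR, Real.mul_rpow (by positivity) (by positivity), Real.mul_rpow (by positivity)
      (by positivity), ← Real.rpow_mul hL.le, ← Real.exp_mul]
    congr 2
    rw [hBdef]; field_simp
  rw [hRe]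
  have h1 : (16 * κ) ^ (1 - ε) ≤ 16 * κ := by
    calc (16 * κ) ^ (1 - ε) ≤ (16 * κ) ^ (1 : ℝ) :=
          Real.rpow_le_rpow_of_exponent_le (by linarith) (by linarith)
      _ = _ := Real.rpow_one _
  have h2 : c * (1 - ε) ≤ (1 / 2 : ℝ) * (Real.exp (80 * C) - 1) := by
    have h3 : Real.exp (80 * C) = Real.exp (40 * C) ^ 2 := by
      rw [← Real.exp_nat_mul]; congr 1; push_cast; ring
    have h4 : Real.exp B ≤ Real.exp (40 * C) := Real.exp_le_exp.2 hB40
    have h5 : c * (1 - ε) ≤ c := mul_le_of_le_one_right hc0 (by linarith)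
    rw [h3]
    nlinarith [sq_nonneg (Real.exp (40 * C) - 1)]
  have h3 : Log t ^ (c * (1 - ε)) ≤ Log t ^ ((1 / 2 : ℝ) * (Real.exp (80 * C) - 1)) :=
    Real.rpow_le_rpow_of_exponent_le hL1 h2
  gcongr

/-- The uniform bound. Primes below `p₀` are removed one at a time at the cost of a constant factor;
if all primes of `P` exceed `p₀` and the bound fails, every prime of `P` forces concentration, with
exceptional sets whose total weight is controlled by the tail of `∑ p ^ (-(1 + ε))`. -/
lemma exists_bound (ε C : ℝ) (hε : 0 < ε) (hε' : ε ≤ 4 / 5) (hC : 0 < C) :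
    ∃ M : ℝ, 0 < M ∧ ∀ (t : ℝ) (P : Finset ℕ), (∀ p ∈ P, p.Prime) →
      Bound P t ε C (M * Log t ^ ((1 / 2 : ℝ) * (Real.exp (80 * C) - 1))) := by
  set q : ℝ := (1 + ε) / 2 with hq
  have hq1 : 0 < 1 - q := by linarith
  have h1ε : 0 < 1 - ε := by linarith
  set c₀ : ℝ := Real.exp (2 * C) with hc₀
  have hc₀0 : 0 < c₀ := Real.exp_pos _
  -- The threshold `x₀` below which the bootstrap inequality of `concentration` operates.
  set x₀ : ℝ := (1 / 8 : ℝ) ^ (1 / ε) with hx₀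
  have hx₀0 : 0 < x₀ := by positivity
  have hx₀1 : x₀ < 1 := Real.rpow_lt_one (by norm_num) (by norm_num) (by positivity)
  have hx₀ε : 8 * x₀ ^ ε ≤ 1 := by
    rw [hx₀, ← Real.rpow_mul (by norm_num), one_div_mul_cancel hε.ne']; norm_num
  set η₀ : ℝ := min 1 (1 - (1 - x₀) ^ (ε / 2)) with hη₀
  have hη₀0 : 0 < η₀ := by
    refine lt_min one_pos ?_
    have := Real.rpow_lt_one (by linarith : 0 ≤ 1 - x₀) (by linarith) (by linarith : 0 < ε / 2)
    linarith
  have hη₀1 : η₀ ≤ 1 := min_le_left _ _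
  have hη₀x : (1 - x₀) ^ (ε / 2) ≤ 1 - η₀ := by
    have := min_le_right 1 (1 - (1 - x₀) ^ (ε / 2))
    linarith
  set ρ : ℝ := min (1 / 2) (η₀ / (4 * c₀)) with hρ
  have hρ0 : 0 < ρ := lt_min (by norm_num) (by positivity)
  obtain ⟨p₁, hp₁⟩ : ∃ p₁ : ℕ, ∀ p : ℕ, p₁ ≤ p → (p : ℝ) ^ (-(1 - q)) ≤ ρ := by
    have h := (tendsto_rpow_neg_atTop hq1).comp (tendsto_natCast_atTop_atTop (R := ℝ))
    exact Filter.eventually_atTop.1 (h.eventually (Iic_mem_nhds hρ0))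
  set D : ℝ := 2 * ((32 * c₀) ^ (1 / (1 - q))) ^ (1 + ε) with hD
  have hD0 : 0 < D := by positivity
  obtain ⟨s, hs⟩ : ∃ s : Finset ℕ, ∀ P : Finset ℕ, Disjoint P s →
      ∑ p ∈ P, (p : ℝ) ^ (-(1 + ε)) ≤ 1 / (2 * D) := by
    have hsum : Summable fun n : ℕ => (n : ℝ) ^ (-(1 + ε)) :=
      Real.summable_nat_rpow.2 (by linarith)
    exact hsum.vanishing (Iic_mem_nhds (by positivity : (0 : ℝ) < 1 / (2 * D)))
  set p₀ : ℕ := max p₁ (s.sup id + 1) with hp₀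
  set r₂ : ℝ := (2 : ℝ) ^ (-(1 - q)) with hr₂
  have hr₂0 : 0 < r₂ := by positivity
  have hr₂1 : r₂ < 1 := Real.rpow_lt_one_of_one_lt_of_neg (by norm_num) (by linarith)
  set b : ℝ := 1 + 2 * c₀ * (r₂ / (1 - r₂)) with hb
  have hb1 : 1 ≤ b := by
    have : 0 ≤ 2 * c₀ * (r₂ / (1 - r₂)) :=
      mul_nonneg (by positivity) (div_nonneg hr₂0.le (by linarith))
    linarith
  obtain ⟨κ, hκ1, hκ⟩ := exists_prod_one_add_div_le (Real.exp (4 * C * (1 + ε) / (1 - ε)) - 1)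
    (by linarith [Real.one_le_exp (by positivity : 0 ≤ 4 * C * (1 + ε) / (1 - ε))])
  have main : ∀ (t : ℝ) (P : Finset ℕ), (∀ p ∈ P, p.Prime) → Bound P t ε C
      (b ^ (P.filter (· < p₀)).card *
        (16 * κ * Log t ^ ((1 / 2 : ℝ) * (Real.exp (80 * C) - 1)))) := by
    intro t P
    have hT : 0 < 16 * κ * Log t ^ ((1 / 2 : ℝ) * (Real.exp (80 * C) - 1)) := by
      have := Log_pos t
      positivity
    induction P using Finset.strongInduction with
    | H P ih =>
      intro hP
      have hPe : ∀ p, ∀ r ∈ P.erase p, r.Prime := fun p r hr => hP r (Finset.mem_of_mem_erase hr)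
      by_cases hsmall : ∃ p ∈ P, p < p₀
      · obtain ⟨p, hp, hpp₀⟩ := hsmall
        have h := ih (P.erase p) (Finset.erase_ssubset hp) (hPe p)
        have hr : (p : ℝ) ^ (-(1 - q)) ≤ r₂ := by
          have h2 : (2 : ℝ) ≤ p := by exact_mod_cast (hP p hp).two_le
          exact Real.rpow_le_rpow_of_nonpos (by norm_num) h2 (by linarith)
        have hr0 : 0 ≤ (p : ℝ) ^ (-(1 - q)) := by positivity
        have hdiv : (p : ℝ) ^ (-(1 - q)) / (1 - (p : ℝ) ^ (-(1 - q))) ≤ r₂ / (1 - r₂) :=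
          div_le_div₀ hr₂0.le hr (by linarith) (by linarith)
        have h3 := Bound.of_erase hP hp hε hε' hC (by positivity) hq rfl (by linarith)
          (b := b) (by rw [hb]; gcongr) h
        have hcard : (P.filter (· < p₀)).card = ((P.erase p).filter (· < p₀)).card + 1 := by
          rw [Finset.filter_erase, Finset.card_erase_add_one]
          exact Finset.mem_filter.2 ⟨hp, hpp₀⟩
        rw [hcard, pow_succ']
        rwa [mul_assoc]
      · push Not at hsmall
        have hcard : (P.filter (· < p₀)).card = 0 := by
          rw [Finset.card_eq_zero, Finset.filter_eq_empty_iff]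
          intro p hp
          exact not_lt.2 (hsmall p hp)
        rw [hcard, pow_zero, one_mul]
        intro I J x y K hI hJ hx hy
        by_contra! hbig
        set Y := pairMass P x y (edges P t K x y I J) with hY
        have hY0 : 0 < Y := lt_of_le_of_lt (by
          have := mass_nonneg hP hx
          have := mass_nonneg hP hy
          positivity) hbig
        have hk : ∀ p, ∃ k : ℕ, p ∈ P → pairMass P x y ((edges P t K x y I J).filter
            fun z => z.1.factorization p ≠ k ∧ z.2.factorization p ≠ k) ≤
            D * (p : ℝ) ^ (-(1 + ε)) * Y := by
          intro p
          by_cases hp : p ∈ P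
          swap
          · exact ⟨0, fun h => absurd h hp⟩
          have hpp₀ := hsmall p hp
          have hB : Bound (P.erase p) t ε C
              (16 * κ * Log t ^ ((1 / 2 : ℝ) * (Real.exp (80 * C) - 1))) := by
            have h := ih (P.erase p) (Finset.erase_ssubset hp) (hPe p)
            have hcard' : ((P.erase p).filter (· < p₀)).card = 0 := by
              rw [Finset.card_eq_zero, Finset.filter_eq_empty_iff]
              intro r hr
              exact not_lt.2 (hsmall r (Finset.mem_of_mem_erase hr))
            rwa [hcard', pow_zero, one_mul] at h
          have hr := hp₁ p ((le_max_left _ _).trans hpp₀)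
          set r : ℝ := (p : ℝ) ^ (-(1 - q)) with hrdef
          have hp0 : (0 : ℝ) < p := by exact_mod_cast (hP p hp).pos
          have hr0 : 0 < r := by positivity
          have hr12 : r ≤ 1 / 2 := hr.trans (min_le_left _ _)
          have hrη : 4 * c₀ * r ≤ η₀ := by
            have h4 := hr.trans (min_le_right _ _)
            rw [le_div_iff₀ (by positivity)] at h4
            linarith
          have hdiv : r / (1 - r) ≤ 2 * r := by
            rw [div_le_iff₀ (by linarith)]; nlinarith
          obtain ⟨k, hk⟩ := exists_concentration hP hp hε hε' hC hT hq hrdef (by linarith)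
            (η := 4 * c₀ * r) (x₀ := x₀)
            (by
              calc 2 * c₀ * (r / (1 - r)) ≤ 2 * c₀ * (2 * r) := by gcongr
                _ = _ := by ring)
            (hrη.trans hη₀1) hx₀1.le hx₀ε (by linarith) hB I J x y K hI hJ hx hy hbig
          refine ⟨k, fun _ => hk.trans (le_of_eq ?_)⟩
          -- The exponent `1 / (1 - q)` turns `r = p ^ (-(1 - q))` into `1 / p`.
          have e1 : r ^ (1 / (1 - q)) = (p : ℝ) ^ (-1 : ℝ) := by
            rw [hrdef, ← Real.rpow_mul hp0.le]; congr 1; field_simp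
          have e2 : (8 * (4 * c₀ * r)) ^ (1 / (1 - q)) =
              (32 * c₀) ^ (1 / (1 - q)) * (p : ℝ) ^ (-1 : ℝ) := by
            rw [← e1, ← Real.mul_rpow (by positivity) hr0.le]; congr 1; ring
          have e3 : ((p : ℝ) ^ (-1 : ℝ)) ^ (1 + ε) = (p : ℝ) ^ (-(1 + ε)) := by
            rw [← Real.rpow_mul hp0.le]; congr 1; ring
          rw [e2, Real.mul_rpow (by positivity) (by positivity), e3, hD]
          ring
        choose k hk using hk
        have hbad : ∑ p ∈ P, pairMass P x y ((edges P t K x y I J).filter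
            fun z => z.1.factorization p ≠ k p ∧ z.2.factorization p ≠ k p) ≤ 1 / 2 * Y := by
          have hdisj : Disjoint P s := by
            rw [Finset.disjoint_left]
            intro p hp hps
            have h1 : p ≤ s.sup id := Finset.le_sup (f := id) hps
            have h2 := hsmall p hp
            have h3 : s.sup id + 1 ≤ p₀ := le_max_right _ _
            omega
          have h1 := hs P hdisj
          calc _ ≤ ∑ p ∈ P, D * (p : ℝ) ^ (-(1 + ε)) * Y :=
                Finset.sum_le_sum fun p hp => hk p hp
            _ = D * (∑ p ∈ P, (p : ℝ) ^ (-(1 + ε))) * Y := by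
                rw [Finset.mul_sum, Finset.sum_mul]
            _ ≤ D * (1 / (2 * D)) * Y := by gcongr
            _ = 1 / 2 * Y := by field_simp
        have hfin := bound_of_concentrated hε hε' hC hκ1 hP
          (hκ t _ (fun p hp => hP p (Finset.mem_filter.1 hp).1)
            fun p hp => (Finset.mem_filter.1 hp).2) I J x y hI hJ hx hy k hbad
        exact absurd hfin (not_le.2 hbig)
  refine ⟨b ^ p₀ * (16 * κ), by positivity, fun t P hP I J x y K hI hJ hx hy => ?_⟩
  refine (main t P hP I J x y K hI hJ hx hy).trans ?_
  have hX : 0 ≤ mass P x I * mass P y J := mul_nonneg (mass_nonneg hP hx) (mass_nonneg hP hy)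
  have hL := Log_pos t
  have hcard : (P.filter (· < p₀)).card ≤ p₀ := by
    calc _ ≤ (Finset.range p₀).card := Finset.card_le_card fun p hp =>
          Finset.mem_range.2 (Finset.mem_filter.1 hp).2
      _ = p₀ := Finset.card_range _
  have hpow : b ^ (P.filter (· < p₀)).card ≤ b ^ p₀ := pow_le_pow_right₀ hb1 hcard
  rw [mul_assoc (b ^ p₀)]
  gcongr

/-! ### Comparison with the arithmetic definitions -/

lemma eq_prod_pow_factorization {P : Finset ℕ} {n : ℕ} (hn : n ≠ 0) (h : n.primeFactors ⊆ P) :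
    n = ∏ p ∈ P, p ^ n.factorization p := by
  conv_lhs => rw [← Nat.prod_factorization_pow_eq_self hn]
  exact Finsupp.prod_of_support_subset _ h _ fun p _ => pow_zero p

lemma gcd_mul_excess {P : Finset ℕ} {v w : ℕ} (hv : v ≠ 0) (hw : w ≠ 0)
    (hwP : w.primeFactors ⊆ P) : (Nat.gcd v w : ℝ) * excess P w v = w := by
  have hg : Nat.gcd v w ≠ 0 := Nat.gcd_ne_zero_left hv
  have hgP : (Nat.gcd v w).primeFactors ⊆ P :=
    (Nat.primeFactors_mono (Nat.gcd_dvd_right v w) hw).trans hwP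
  conv_lhs => rw [eq_prod_pow_factorization hg hgP]
  conv_rhs => rw [eq_prod_pow_factorization hw hwP]
  unfold excess
  push_cast
  rw [← Finset.prod_mul_distrib]
  refine Finset.prod_congr rfl fun p _ => ?_
  rw [← pow_add, Nat.factorization_gcd hv hw, Finsupp.inf_apply]
  congr 1
  rcases le_total (v.factorization p) (w.factorization p) with h | h
  · rw [inf_eq_left.2 h]; omega
  · rw [inf_eq_right.2 h]; omega

lemma weight_phi_eq_wt {P : Finset ℕ} (ψ : ℕ →₀ ℝ≥0) {v : ℕ} (hv : v ≠ 0)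
    (hvP : v.primeFactors ⊆ P) : weight phi ψ v = wt P (fun u => (ψ u : ℝ)) v := by
  have h : ((v.totient : ℚ) : ℝ) = ((v * ∏ p ∈ v.primeFactors, (1 - (p : ℚ)⁻¹) : ℚ) : ℝ) := by
    rw [Nat.totient_eq_mul_prod_factors]
  push_cast at h
  have hprod : ∏ p ∈ P, density p (v.factorization p) =
      ∏ p ∈ v.primeFactors, (1 - (p : ℝ)⁻¹) := by
    symm
    refine (Finset.prod_congr rfl fun p hp => ?_).trans (Finset.prod_subset hvP fun p _ hp => ?_)
    · have : v.factorization p ≠ 0 := by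
        rw [← Finsupp.mem_support_iff, Nat.support_factorization]; exact hp
      simp [density, this]
    · have : v.factorization p = 0 := by
        rw [← Finsupp.notMem_support_iff, Nat.support_factorization]; exact hp
      simp [density, this]
  have hv0 : (v : ℝ) ≠ 0 := by exact_mod_cast hv
  unfold weight wt phi
  rw [hprod, h]
  field_simp

lemma omega_le_omegaOn {P : Finset ℕ} (t : ℝ) {v w : ℕ} (hv : v ≠ 0) (hw : w ≠ 0)
    (hvP : v.primeFactors ⊆ P) (hwP : w.primeFactors ⊆ P) : omega t v w ≤ omegaOn P t v w := by
  have hdvd : Nat.gcd v w ^ 2 ∣ v * w := by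
    rw [sq]; exact mul_dvd_mul (Nat.gcd_dvd_left v w) (Nat.gcd_dvd_right v w)
  have hvw : v * w ≠ 0 := mul_ne_zero hv hw
  unfold omega omegaOn
  refine Finset.card_le_card fun p hp => ?_
  obtain ⟨hp, hpt⟩ := Finset.mem_filter.1 hp
  refine Finset.mem_filter.2 ⟨?_, hpt, fun heq => ?_⟩
  · have h := Nat.primeFactors_mono (Nat.div_dvd_of_dvd hdvd) hvw hp
    rw [Nat.primeFactors_mul hv hw] at h
    rcases Finset.mem_union.1 h with h | h
    · exact hvP h
    · exact hwP h
  · rw [← Nat.support_factorization, Finsupp.mem_support_iff] at hp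
    apply hp
    rw [Nat.factorization_div hdvd, Nat.factorization_mul hv hw, Nat.factorization_pow,
      Nat.factorization_gcd hv hw]
    simp only [Finsupp.coe_tsub, Finsupp.coe_add, Finsupp.coe_smul, Pi.sub_apply, Pi.add_apply,
      Pi.smul_apply, Finsupp.inf_apply, smul_eq_mul, heq, inf_idem]
    omega

end DuffinSchaeffer

theorem mainTheorem2 (ε C : ℝ) (hε : 0 < ε) (hε' : ε ≤ 4 / 5) (hC : 0 < C) :
    ∃ M : ℝ, 0 < M ∧
      ∀ (t K : ℝ) (ψ : ℕ →₀ ℝ≥0), 1 ≤ t → ψ 0 = 0 →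
        DuffinSchaeffer.muPair DuffinSchaeffer.phi DuffinSchaeffer.phi ψ ψ
            (DuffinSchaeffer.pairSet ψ ψ t K) ≤
          M * DuffinSchaeffer.Log t ^ ((1 / 2 : ℝ) * (Real.exp (80 * C) - 1)) *
            Real.exp (-(C * K * (1 + ε))) *
            DuffinSchaeffer.mu DuffinSchaeffer.phi ψ ψ.support ^ (1 + ε) := by
  obtain ⟨M, hM, hbound⟩ := DuffinSchaeffer.exists_bound ε C hε hε' hC
  refine ⟨M, hM, fun t K ψ _ hψ0 => ?_⟩
  set V := ψ.support with hV
  set P : Finset ℕ := V.biUnion Nat.primeFactors with hP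
  have hPp : ∀ p ∈ P, p.Prime := by
    intro p hp
    obtain ⟨v, _, hv⟩ := Finset.mem_biUnion.1 hp
    exact Nat.prime_of_mem_primeFactors hv
  have hsub : ∀ v ∈ V, v.primeFactors ⊆ P := fun v hv => Finset.subset_biUnion_of_mem _ hv
  have hne : ∀ v ∈ V, v ≠ 0 := by
    rintro v hv rfl
    exact Finsupp.mem_support_iff.1 hv hψ0
  set x : ℕ → ℝ := fun u => (ψ u : ℝ) with hx
  have hxpos : ∀ v ∈ V, 0 < x v := fun v hv =>
    NNReal.coe_pos.2 (pos_iff_ne_zero.2 (Finsupp.mem_support_iff.1 hv))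
  have hsep : DuffinSchaeffer.Separated P V := by
    intro v hv w hw h
    refine Nat.eq_of_factorization_eq (hne v hv) (hne w hw) fun p => ?_
    by_cases hp : p ∈ P
    · exact h p hp
    · have h0 : ∀ u ∈ V, u.factorization p = 0 := fun u hu => by
        rw [← Finsupp.notMem_support_iff, Nat.support_factorization]
        exact fun hpu => hp (hsub u hu hpu)
      rw [h0 v hv, h0 w hw]
  have hwt : ∀ v ∈ V, DuffinSchaeffer.weight DuffinSchaeffer.phi ψ v =
      DuffinSchaeffer.wt P x v := fun v hv =>
    DuffinSchaeffer.weight_phi_eq_wt ψ (hne v hv) (hsub v hv)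
  have hmu : DuffinSchaeffer.mu DuffinSchaeffer.phi ψ V = DuffinSchaeffer.mass P x V :=
    Finset.sum_congr rfl hwt
  have hpairs : DuffinSchaeffer.pairSet ψ ψ t K ⊆ DuffinSchaeffer.edges P t K x x V V := by
    rintro ⟨v, w⟩ hz
    obtain ⟨hvw, hD, hK⟩ := Finset.mem_filter.1 hz
    obtain ⟨hv, hw⟩ := Finset.mem_product.1 hvw
    have hv0 := hne v hv
    have hw0 := hne w hw
    have hg : (0 : ℝ) < Nat.gcd v w := by
      exact_mod_cast Nat.pos_of_ne_zero (Nat.gcd_ne_zero_left hv0)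
    unfold DuffinSchaeffer.D at hD
    rw [div_le_one hg, max_le_iff] at hD
    refine Finset.mem_filter.2 ⟨hvw, ?_, ?_, hK.trans ?_⟩
    · refine le_of_mul_le_mul_left ?_ hg
      have h := DuffinSchaeffer.gcd_mul_excess hv0 hw0 (hsub w hw)
      calc (Nat.gcd v w : ℝ) * (x v * DuffinSchaeffer.excess P w v)
          = (Nat.gcd v w : ℝ) * DuffinSchaeffer.excess P w v * x v := by ring
        _ = w * x v := by rw [h]
        _ ≤ _ := by rw [mul_one]; exact hD.1
    · refine le_of_mul_le_mul_left ?_ hg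
      have h := DuffinSchaeffer.gcd_mul_excess hw0 hv0 (hsub v hv)
      rw [Nat.gcd_comm] at h
      calc (Nat.gcd v w : ℝ) * (x w * DuffinSchaeffer.excess P v w)
          = (Nat.gcd v w : ℝ) * DuffinSchaeffer.excess P v w * x w := by ring
        _ = v * x w := by rw [h]
        _ ≤ _ := by rw [mul_one]; exact hD.2
    · exact_mod_cast DuffinSchaeffer.omega_le_omegaOn t hv0 hw0 (hsub v hv) (hsub w hw)
  have hle : DuffinSchaeffer.muPair DuffinSchaeffer.phi DuffinSchaeffer.phi ψ ψ
      (DuffinSchaeffer.pairSet ψ ψ t K) ≤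
      DuffinSchaeffer.pairMass P x x (DuffinSchaeffer.edges P t K x x V V) := by
    have hmem : ∀ z ∈ DuffinSchaeffer.edges P t K x x V V, z.1 ∈ V ∧ z.2 ∈ V := fun z hz =>
      Finset.mem_product.1 (Finset.mem_filter.1 hz).1
    calc _ = DuffinSchaeffer.pairMass P x x (DuffinSchaeffer.pairSet ψ ψ t K) :=
          Finset.sum_congr rfl fun z hz => by
            rw [hwt _ (hmem z (hpairs hz)).1, hwt _ (hmem z (hpairs hz)).2]
      _ ≤ _ := DuffinSchaeffer.pairMass_mono hpairs fun z hz =>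
          (mul_pos (DuffinSchaeffer.wt_pos hPp (hxpos _ (hmem z hz).1))
            (DuffinSchaeffer.wt_pos hPp (hxpos _ (hmem z hz).2))).le
  refine hle.trans ((hbound t P hPp V V x x K hsep hsep hxpos hxpos).trans (le_of_eq ?_))
  have hm := DuffinSchaeffer.mass_nonneg hPp hxpos
  rw [hmu, ← sq, ← Real.rpow_natCast (DuffinSchaeffer.mass P x V) 2, ← Real.rpow_mul hm]
  congr 2
  push_cast; ring
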